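/- **Setting.** Consider a finite normal-form game with $N\ge 1$ players, non-empty finite action sets $\mathcal A_1,\dots,\mathcal A_N$, $A=\max_i|\mathcal A_i|$, and utilities $u_i:\prod_j\mathcal A_j\to[0,1]$ that are unknown to the players. Each play of the game is one sample: an action profile $a$ is played, and each player $i$ receives a random payoff $U_i\in[0,1]$ whose conditional mean, given the past and $a$, is $u_i(a)$. Let $\epsilon,\Delta\in(0,1]$ and $\delta\in(0,1)$. **Rationalizability.** Let $E_0=\emptyset$. For $l\ge 1$, let $E_l$ be the set of all actions $a\in\mathcal A_i$, $i\in[N]$, for which there is a distribution $x$ on $\mathcal A_i$ with $u_i(a,a_{-i})\le u_i(x,a_{-i})-\Delta$ for every $a_{-i}$ that contains no action of $E_{l-1}$. Let $L=\min\{l\ge 1: E_{l+1}=E_l\}$. An action is *$\Delta$-rationalizable* if it is not in $E_L$. A distribution $\Pi$ on $\prod_j\mathcal A_j$ is an *$\epsilon$-CCE* if $\mathbb E_{a\sim\Pi}[u_i(a)]\ge \mathbb E_{a\sim\Pi}[u_i(a',a_{-i})]-\epsilon$ for all $i$ and all $a'\in\mathcal A_i$. **Algorithm, with $T$ rounds.**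 Put $p=\frac{\min\{\epsilon,\Delta\}}{8AN}$, and for $t\ge 1$ $$\eta_t=\max\Big\{\sqrt{\tfrac{\ln A}{t}},\ \tfrac{4\ln(1/p)}{\Delta t}\Big\},\qquad M_t=\Big\lceil\tfrac{64\ln(ANT/\delta)}{\Delta^2t}\Big\rceil,\qquad M=\Big\lceil\tfrac{64\ln(LNA/\delta)}{\Delta^2}\Big\rceil .$$ 1. (Iterative best response.) Choose a profile $a^{(0)}$ arbitrarily. For $l=1,\dots,L$ and each player $i$: for every $a\in\mathcal A_i$, play $(a,a_{-i}^{(l-1)})$ $M$ times, and let $a_i^{(l)}$ be an action with the highest average payoff of player $i$ (ties broken arbitrarily). 2. (Hedge.) Let $\theta_i^{(1)}$ be the point mass at $a_i^{(L)}$. For $t=1,\dots,T$ and each player $i$: for every $a\in\mathcal A_i$, play $M_t$ times with player $i$ playing $a$ and the other players drawing their actions independently from $\theta_j^{(t)}$, $j\ne i$; let $u_i^{(t)}(a)$ be player $i$'s average payoff; and set $\theta_i^{(t+1)}(\cdot)\propto\exp\big(\eta_t\sum_{\tau=1}^t u_i^{(\tau)}(\cdot)\big)$. 3. (Clipping.)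 For all $t\in[T]$ and $i\in[N]$, remove from $\theta_i^{(t)}$ all actions with probability smaller than $p$ and renormalize, which gives $\bar\theta_i^{(t)}$. Output $\Pi=\frac1T\sum_{t=1}^T\bigotimes_{i=1}^N\bar\theta_i^{(t)}$. **Theorem.** There are universal constants $C>0$ and $k\in\mathbb N$, and a number of rounds $T_0=T_0(N,A,\epsilon,\Delta,\delta)\in\mathbb N$ with $$T_0\le C\,\ln^k\!\Big(\frac{2NA}{\epsilon\Delta\delta}\Big)\Big(\frac1{\epsilon^2}+\frac1{\epsilon\Delta}\Big),$$ such that, for every game and all $\epsilon,\Delta,\delta$ as above: for every $T\ge T_0$, with probability at least $1-3\delta$, the output $\Pi$ of the algorithm with $T$ rounds is an $\epsilon$-CCE whose support contains only profiles of $\Delta$-rationalizable actions; and the total number of samples used by the algorithm with $T=T_0$ is at most $$C\,\ln^k\!\Big(\frac{2NAL}{\epsilon\Delta\delta}\Big)\Big(\frac{LNA}{\Delta^2}+\frac{NA}{\epsilon^2}\Big).$$ -/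

import Mathlib

open MeasureTheory Finset

noncomputable section

namespace RationalizableCCE

universe u v

/-- A finite normal-form game with players `Fin N`, action sets `A i`, and utilities in `[0,1]`. -/
structure Game {N : ℕ} (A : Fin N → Type u) where
  /-- `util i b` is the expected payoff of player `i` under the action profile `b`. -/
  util : Fin N → (∀ j, A j) → ℝ
  util_mem : ∀ i b, util i b ∈ Set.Icc (0 : ℝ) 1

section Preliminaries

variable {N : ℕ} {A : Fin N → Type u}

/-- The maximum number of actions of a player. -/
def maxActions (A : Fin N → Type u) [∀ i, Fintype (A i)] : ℕ :=
  Finset.univ.sup fun i => Fintype.card (A i)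

/-- The set `E_l` of actions (of all players) eliminated within `l` rounds of iterated
`Δ`-dominance elimination, with `E_0 = ∅`. -/
def elim [∀ i, Fintype (A i)] (G : Game A) (Δ : ℝ) : ℕ → Set (Σ i, A i)
  | 0 => ∅
  | l + 1 => {p | ∃ x ∈ stdSimplex ℝ (A p.1), ∀ b : ∀ j, A j,
      (∀ j, j ≠ p.1 → (⟨j, b j⟩ : Σ i, A i) ∉ elim G Δ l) →
        G.util p.1 (Function.update b p.1 p.2)
          ≤ (∑ a, x a * G.util p.1 (Function.update b p.1 a)) - Δ}

/-- The minimum elimination length `L`, the least `l ≥ 1` with `E_{l+1} = E_l`. -/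
def elimLength [∀ i, Fintype (A i)] (G : Game A) (Δ : ℝ) : ℕ :=
  sInf {l | 1 ≤ l ∧ elim G Δ (l + 1) = elim G Δ l}

/-- The action `a` of player `i` is `Δ`-rationalizable. -/
def Rationalizable [∀ i, Fintype (A i)] (G : Game A) (Δ : ℝ) (i : Fin N) (a : A i) : Prop :=
  (⟨i, a⟩ : Σ i, A i) ∉ elim G Δ (elimLength G Δ)

/-- The correlated strategy `P` (a distribution on action profiles) is an `ε`-CCE. -/
def IsCCE [∀ i, Fintype (A i)] (G : Game A) (ε : ℝ) (P : (∀ j, A j) → ℝ) : Prop :=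
  P ∈ stdSimplex ℝ (∀ j, A j) ∧
    ∀ (i : Fin N) (a : A i),
      (∑ b, P b * G.util i (Function.update b i a)) - ε ≤ ∑ b, P b * G.util i b

/-- `P` plays only `Δ`-rationalizable actions. -/
def PlaysRationalizable [∀ i, Fintype (A i)] (G : Game A) (Δ : ℝ) (P : (∀ j, A j) → ℝ) : Prop :=
  ∀ b, P b ≠ 0 → ∀ i, Rationalizable G Δ i (b i)

end Preliminaries

section Parameters

/-- The clipping threshold `p` (`n` players, at most `m` actions each). -/
def clipThreshold (n m : ℕ) (ε Δ : ℝ) : ℝ := min ε Δ / (8 * m * n)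

/-- The learning rate `η_t`, `t ≥ 1`. -/
def learningRate (n m : ℕ) (ε Δ : ℝ) (t : ℕ) : ℝ :=
  max (Real.sqrt (Real.log m / t)) (4 * Real.log (1 / clipThreshold n m ε Δ) / (Δ * t))

/-- The minibatch size `M_t`, `t ≥ 1`, of the Hedge phase with `T` rounds. -/
def batchSize (n m : ℕ) (Δ δ : ℝ) (T t : ℕ) : ℕ :=
  ⌈64 * Real.log (m * n * T / δ) / (Δ ^ 2 * t)⌉₊

/-- The batch size of the iterative best response subroutine with `L` rounds. -/
def initBatchSize (n m L : ℕ) (Δ δ : ℝ) : ℕ :=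
  ⌈64 * Real.log (L * n * m / δ) / Δ ^ 2⌉₊

end Parameters

section Algorithm

variable {N : ℕ} {A : Fin N → Type u} [∀ i, Fintype (A i)]

/-- The plays (samples) made by the algorithm with `T` Hedge rounds. `Sum.inl (l, ⟨i, a⟩, m)` is the
`m`-th play of action `a` by the exploring player `i` in round `l + 1` of iterative best response;
`Sum.inr ⟨t, ⟨i, a⟩, m⟩` is the `m`-th play of action `a` by the exploring player `i` in round
`t + 1` of the Hedge phase. -/
abbrev Slot (G : Game A) (Δ δ : ℝ) (T : ℕ) : Type u :=
  (Fin (elimLength G Δ) × (Σ i, A i) ×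
      Fin (initBatchSize N (maxActions A) (elimLength G Δ) Δ δ)) ⊕
    (Σ t : Fin T, (Σ i, A i) × Fin (batchSize N (maxActions A) Δ δ T (t + 1)))

/-- The total number of samples (joint plays of the game) used by the algorithm. -/
def sampleCount (G : Game A) (Δ δ : ℝ) (T : ℕ) : ℕ := Fintype.card (Slot G Δ δ T)

variable {G : Game A} {Δ δ : ℝ} {T : ℕ}

/-- The index of the round (best response rounds first, then Hedge rounds) of a play. -/
def Slot.round : Slot G Δ δ T → ℕ
  | Sum.inl (l, _, _) => l
  | Sum.inr ⟨t, _, _⟩ => elimLength G Δ + t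

/-- The exploring player of a play, with the action that this player tries. -/
def Slot.explored : Slot G Δ δ T → Σ i, A i
  | Sum.inl (_, p, _) => p
  | Sum.inr ⟨_, p, _⟩ => p

/-- The average payoff of action `p.2` of player `p.1` in best response round `l + 1`, where `r s`
is the payoff received by the exploring player in play `s`. -/
def initAverage (r : Slot G Δ δ T → ℝ) (l : Fin (elimLength G Δ)) (p : Σ i, A i) : ℝ :=
  (∑ m, r (Sum.inl (l, p, m))) / initBatchSize N (maxActions A) (elimLength G Δ) Δ δ

/-- The average payoff `u_i^{(t+1)}(a)`, `p = ⟨i, a⟩`, in Hedge round `t + 1`. -/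
def hedgeAverage (r : Slot G Δ δ T → ℝ) (t : Fin T) (p : Σ i, A i) : ℝ :=
  (∑ m, r (Sum.inr ⟨t, p, m⟩)) / batchSize N (maxActions A) Δ δ T (t + 1)

/-- The point mass at `a`, as a mixed strategy. -/
def pointMass {B : Type u} (a : B) : B → ℝ := by
  classical exact fun b => if b = a then 1 else 0

/-- The Hedge strategies: `hedge ε astar r t i` is the mixed strategy `θ_i^{(t+1)}`, namely the
point mass at `astar i` for `t = 0`, and proportional to
`exp (η_t * (u_i^{(1)} + ⋯ + u_i^{(t)}))` for `t ≥ 1`. -/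
def hedge (ε : ℝ) (astar : ∀ j, A j) (r : Slot G Δ δ T → ℝ) : ℕ → ∀ i, A i → ℝ
  | 0, i, a => pointMass (astar i) a
  | t + 1, i, a =>
      let w : A i → ℝ := fun a' => Real.exp (learningRate N (maxActions A) ε Δ (t + 1) *
        ∑ τ ∈ Finset.univ.filter (fun τ : Fin T => (τ : ℕ) < t + 1), hedgeAverage r τ ⟨i, a'⟩)
      w a / ∑ a', w a'

/-- Remove the actions with probability smaller than `p`, and renormalize. -/
def clip {B : Type u} [Fintype B] (p : ℝ) (x : B → ℝ) (a : B) : ℝ :=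
  if x a < p then 0 else x a / ∑ b with p ≤ x b, x b

/-- The output: the average over the `T` rounds of the products of the clipped strategies. -/
def output (ε : ℝ) (astar : ∀ j, A j) (r : Slot G Δ δ T → ℝ) (b : ∀ j, A j) : ℝ :=
  (∑ t ∈ Finset.range T,
    ∏ i, clip (clipThreshold N (maxActions A) ε Δ) (hedge ε astar r t i) (b i)) / T

/-- The mixed strategies that the non-exploring players use in play `s`: in best response round
`l + 1` the pure profile `prof l`, and in Hedge round `t + 1` the strategies `θ^{(t+1)}`,
initialized at the result `prof L` of the best response phase. -/
def strategyAt (ε : ℝ) (prof : ℕ → ∀ j, A j) (r : Slot G Δ δ T → ℝ) :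
    Slot G Δ δ T → ∀ i, A i → ℝ
  | Sum.inl (l, _, _) => fun i => pointMass (prof l i)
  | Sum.inr ⟨t, _, _⟩ => hedge ε (prof (elimLength G Δ)) r t

/-- The probability of the profile `b` when player `p.1` plays `p.2` and the other players draw
their actions independently from the mixed strategies `x`. -/
def explorationLaw (x : ∀ j, A j → ℝ) (p : Σ i, A i) (b : ∀ j, A j) : ℝ := by
  classical exact if b p.1 = p.2 then ∏ j ∈ Finset.univ.erase p.1, x j (b j) else 0

/-- A run, on a probability space `(Ω, μ)`, of the algorithm with target accuracies `ε` and `Δ`,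
confidence parameter `δ` and `T` Hedge rounds, in the game `G` under bandit feedback. The players
do not see `G`: they use only the payoffs that they receive. -/
structure Run (G : Game A) (ε Δ δ : ℝ) (T : ℕ) {Ω : Type v} [mΩ : MeasurableSpace Ω]
    (μ : Measure Ω) where
  /-- The order in which the plays are made. -/
  time : Slot G Δ δ T ≃ Fin (sampleCount G Δ δ T)
  /-- Rounds are made one after the other; the order within a round is arbitrary. -/
  time_lt : ∀ s s', Slot.round s < Slot.round s' → time s < time s'
  /-- The information available before the play made at time `k`. -/
  history : Filtration ℕ mΩ
  /-- The action profile played. -/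
  act : Slot G Δ δ T → Ω → ∀ j, A j
  /-- The payoffs received: `fb s ω i` is the random feedback `U_i` of player `i` in play `s`. -/
  fb : Slot G Δ δ T → Ω → Fin N → ℝ
  /-- `prof l` is the profile of the best response phase after `l` rounds; `prof 0` is arbitrary. -/
  prof : ℕ → Ω → ∀ j, A j
  act_adapted : ∀ s b, MeasurableSet[history ((time s : ℕ) + 1)] {ω | act s ω = b}
  fb_adapted : ∀ s i, Measurable[history ((time s : ℕ) + 1)] fun ω => fb s ω i
  /-- The profile `prof l` is chosen before any later round starts. -/
  prof_adapted : ∀ s l, l ≤ elimLength G Δ → l ≤ Slot.round s →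
    ∀ b, MeasurableSet[history (time s)] {ω | prof l ω = b}
  fb_mem : ∀ s ω i, fb s ω i ∈ Set.Icc (0 : ℝ) 1
  /-- Bandit feedback: given the past and the profile just played, `U_i` has mean `u_i`. -/
  fb_mean : ∀ s i,
    μ[fun ω => fb s ω i |
        history (time s) ⊔ MeasurableSpace.comap (act s) (⊤ : MeasurableSpace (∀ j, A j))]
      =ᵐ[μ] fun ω => G.util i (act s ω)
  /-- Iterative best response: each player moves to an empirical best response, with ties broken
  arbitrarily. -/
  prof_best : ∀ (l : Fin (elimLength G Δ)) (ω : Ω) (i : Fin N) (a : A i),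
    initAverage (fun s => fb s ω (Slot.explored s).1) l ⟨i, a⟩
      ≤ initAverage (fun s => fb s ω (Slot.explored s).1) l ⟨i, prof (l + 1) ω i⟩
  /-- Given the past, the profile of play `s` is drawn as the algorithm prescribes. -/
  act_law : ∀ s b,
    μ[Set.indicator {ω | act s ω = b} (fun _ => (1 : ℝ)) | history (time s)]
      =ᵐ[μ] fun ω => explorationLaw
        (strategyAt ε (fun l => prof l ω) (fun s' => fb s' ω (Slot.explored s').1) s)
        (Slot.explored s) b

/-- The correlated strategy that the run outputs. -/
def Run.result {ε : ℝ} {Ω : Type v} [MeasurableSpace Ω] {μ : Measure Ω}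
    (R : Run G ε Δ δ T μ) (ω : Ω) : (∀ j, A j) → ℝ :=
  output ε (R.prof (elimLength G Δ) ω) fun s => R.fb s ω (Slot.explored s).1

end Algorithm

end RationalizableCCE

end

/-! If every estimate of the best response phase is accurate to within `Δ / 2`, then round `l` of
that phase leaves every player at an action outside `E_l`, so Hedge starts at a profile of
rationalizable actions. From there eliminated actions never become likely: while they have
probability at most `p`, the opponents leave the rationalizable profiles with probability at most
`N A p ≤ Δ / 8`, so an eliminated action loses at least `3 Δ / 4` per round to another action. If
the cumulative estimates of the first `t` rounds are accurate to within `t Δ / 4`, its probability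
in the next round is therefore below `exp (-η_t t Δ / 4) ≤ p`, by the second term in the
definition of `η_t`. Hence clipping removes all eliminated actions, and it changes expected
payoffs by at most `ε / 8`.

Minibatch sizes `M_t` proportional to `1 / t` achieve this accuracy for all `t` at once, by the
Azuma–Hoeffding inequality, and since `∑ 1 / t` is logarithmic they cost little more than one play
per round and action. The estimation errors enter the regret only through two martingales, which
add `O(√T)` up to logarithms to the regret `O(√(T ln A) + ln (1 / p) ln T / Δ)` of Hedge, although
the individual estimates of late rounds, with `M_t = 1`, are not accurate at all. -/

noncomputable section

namespace RationalizableCCE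

universe u v

section Concentration

lemma exp_mul_le_cosh_add_mul_sinh (s : ℝ) {d : ℝ} (hd : |d| ≤ 1) :
    Real.exp (s * d) ≤ Real.cosh s + d * Real.sinh s := by
  obtain ⟨h₁, h₂⟩ := abs_le.1 hd
  have chord := convexOn_exp.2 (Set.mem_univ s) (Set.mem_univ (-s))
    (show 0 ≤ (1 + d) / 2 by linarith) (show 0 ≤ (1 - d) / 2 by linarith) (by ring)
  simp only [smul_eq_mul] at chord
  rw [show (1 + d) / 2 * s + (1 - d) / 2 * -s = s * d by ring] at chord
  rw [Real.cosh_eq, Real.sinh_eq]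
  linarith

lemma exp_neg_half_sq_mul_cosh_le_one (s : ℝ) : Real.exp (-(s ^ 2 / 2)) * Real.cosh s ≤ 1 := by
  rw [Real.exp_neg, inv_mul_le_one₀ (Real.exp_pos _)]
  exact Real.cosh_le_exp_half_sq s

lemma abs_exp_neg_half_sq_mul_sinh_le_one (s : ℝ) :
    |Real.exp (-(s ^ 2 / 2)) * Real.sinh s| ≤ 1 := by
  rw [abs_mul, Real.abs_exp, Real.abs_sinh]
  calc Real.exp (-(s ^ 2 / 2)) * Real.sinh |s|
      ≤ Real.exp (-(s ^ 2 / 2)) * Real.cosh |s| := by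
        gcongr
        exact (Real.sinh_lt_cosh _).le
    _ ≤ 1 := by
        rw [Real.cosh_abs]
        exact exp_neg_half_sq_mul_cosh_le_one s

lemma exp_mul_sub_half_sq_le (s : ℝ) {d : ℝ} (hd : |d| ≤ 1) :
    Real.exp (s * d - s ^ 2 / 2) ≤ 1 + Real.exp (-(s ^ 2 / 2)) * Real.sinh s * d := by
  calc Real.exp (s * d - s ^ 2 / 2) = Real.exp (-(s ^ 2 / 2)) * Real.exp (s * d) := by
        rw [← Real.exp_add]
        ring_nf
    _ ≤ Real.exp (-(s ^ 2 / 2)) * (Real.cosh s + d * Real.sinh s) := by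
        gcongr
        exact exp_mul_le_cosh_add_mul_sinh s hd
    _ ≤ 1 + Real.exp (-(s ^ 2 / 2)) * Real.sinh s * d := by
        linarith [exp_neg_half_sq_mul_cosh_le_one s]

variable {Ω : Type*} {m mΩ : MeasurableSpace Ω} {μ : Measure Ω}

lemma condExp_mul_eq_zero_of_condExp_eq_zero {X Y : Ω → ℝ} {B : ℝ} (hm : m ≤ mΩ)
    (hX : Integrable X μ) (hX₀ : μ[X | m] =ᵐ[μ] 0) (hY : StronglyMeasurable[m] Y)
    (hB : ∀ᵐ ω ∂μ, ‖Y ω‖ ≤ B) : μ[Y * X | m] =ᵐ[μ] 0 := by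
  have hYX : Integrable (Y * X) μ := hX.bdd_mul (hY.mono hm).aestronglyMeasurable hB
  filter_upwards [condExp_mul_of_stronglyMeasurable_left hY hYX hX, hX₀] with ω h h₀
  rw [h, Pi.mul_apply, h₀, Pi.zero_apply, mul_zero]

lemma integrable_of_mem_Icc [IsFiniteMeasure μ] {X : Ω → ℝ} (hXm : Measurable X) {a b : ℝ}
    (hX : ∀ ω, X ω ∈ Set.Icc a b) : Integrable X μ :=
  Integrable.of_mem_Icc a b hXm.aemeasurable (.of_forall hX)

lemma ae_abs_sub_condExp_le [IsFiniteMeasure μ] (hm : m ≤ mΩ) {X : Ω → ℝ}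
    (hXm : Measurable X) {a b : ℝ} (hX : ∀ ω, X ω ∈ Set.Icc a b) :
    ∀ᵐ ω ∂μ, |X ω - (μ[X | m]) ω| ≤ b - a := by
  filter_upwards [(convex_Icc a b).condExp_mem hm (integrable_of_mem_Icc hXm hX) isClosed_Icc
    (.of_forall hX)] with ω hω
  rw [abs_le]
  constructor <;> linarith [(hX ω).1, (hX ω).2, hω.1, hω.2]

lemma condExp_sub_condExp_eq_zero {X : Ω → ℝ} [IsFiniteMeasure μ] (hm : m ≤ mΩ)
    (hX : Integrable X μ) : μ[X - μ[X | m] | m] =ᵐ[μ] 0 := by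
  filter_upwards [condExp_sub hX integrable_condExp m,
    condExp_condExp_of_le (μ := μ) (f := X) le_rfl hm] with ω h₁ h₂
  rw [h₁, Pi.sub_apply, h₂, sub_self, Pi.zero_apply]

/-- The exponential process `exp (∑ (w k * D k - w k ^ 2 / 2))`, a supermartingale when the `D k`
are martingale differences bounded by `1` and the weights `w k` are predictable. -/
def compensatedExp (w D : ℕ → Ω → ℝ) (n : ℕ) (ω : Ω) : ℝ :=
  Real.exp (∑ k ∈ range n, (w k ω * D k ω - w k ω ^ 2 / 2))

lemma compensatedExp_pos (w D : ℕ → Ω → ℝ) (n : ℕ) (ω : Ω) : 0 < compensatedExp w D n ω :=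
  Real.exp_pos _

lemma compensatedExp_succ_le (w D : ℕ → Ω → ℝ) (n : ℕ) {ω : Ω} (hD : |D n ω| ≤ 1) :
    compensatedExp w D (n + 1) ω ≤ compensatedExp w D n ω +
      compensatedExp w D n ω * (Real.exp (-(w n ω ^ 2 / 2)) * Real.sinh (w n ω)) * D n ω := by
  unfold compensatedExp
  rw [sum_range_succ, Real.exp_add]
  grw [exp_mul_sub_half_sq_le (w n ω) hD]
  exact le_of_eq (by ring)

lemma compensatedExp_le_exp {w D : ℕ → Ω → ℝ} {B : ℝ} (n : ℕ) {ω : Ω} (hw : ∀ k, |w k ω| ≤ B)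
    (hD : ∀ k, |D k ω| ≤ 1) : compensatedExp w D n ω ≤ Real.exp (n * B) := by
  refine Real.exp_le_exp.2 ?_
  calc ∑ k ∈ range n, (w k ω * D k ω - w k ω ^ 2 / 2) ≤ ∑ _k ∈ range n, B := by
        gcongr with k
        calc w k ω * D k ω - w k ω ^ 2 / 2 ≤ |w k ω * D k ω| := by
              linarith [le_abs_self (w k ω * D k ω), sq_nonneg (w k ω)]
          _ = |w k ω| * |D k ω| := abs_mul _ _
          _ ≤ |w k ω| := mul_le_of_le_one_right (abs_nonneg _) (hD k)
          _ ≤ B := hw k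
    _ = n * B := by simp

variable {F : Filtration ℕ mΩ} {w D : ℕ → Ω → ℝ}

lemma measurable_compensatedExp (hwm : ∀ k, Measurable[F k] (w k))
    (hDm : ∀ k, Measurable[F (k + 1)] (D k)) (n : ℕ) :
    Measurable[F n] (compensatedExp w D n) := by
  refine Real.measurable_exp.comp (measurable_fun_sum _ fun k hk => ?_)
  have hk : k < n := mem_range.1 hk
  have hw : Measurable[F n] (w k) := (hwm k).mono (F.mono hk.le) le_rfl
  have hD : Measurable[F n] (D k) := (hDm k).mono (F.mono hk) le_rfl
  exact (hw.mul hD).sub ((hw.pow_const 2).div_const 2)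

variable [IsProbabilityMeasure μ]

theorem supermartingale_compensatedExp {B : ℝ} (hwm : ∀ k, Measurable[F k] (w k))
    (hw : ∀ k ω, |w k ω| ≤ B) (hDm : ∀ k, Measurable[F (k + 1)] (D k))
    (hD : ∀ k, ∀ᵐ ω ∂μ, |D k ω| ≤ 1) (hD₀ : ∀ k, μ[D k | F k] =ᵐ[μ] 0) :
    Supermartingale (compensatedExp w D) F μ := by
  have hmeas := measurable_compensatedExp hwm hDm
  have hbdd (n : ℕ) : ∀ᵐ ω ∂μ, ‖compensatedExp w D n ω‖ ≤ Real.exp (n * B) := by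
    filter_upwards [ae_all_iff.2 hD] with ω hω
    rw [Real.norm_of_nonneg (compensatedExp_pos _ _ _ _).le]
    exact compensatedExp_le_exp n (hw · ω) hω
  have hint (n : ℕ) : Integrable (compensatedExp w D n) μ :=
    .of_bound ((hmeas n).mono (F.le n) le_rfl).aestronglyMeasurable _ (hbdd n)
  refine supermartingale_nat (fun n => (hmeas n).stronglyMeasurable) hint fun n => ?_
  have hDi : Integrable (D n) μ :=
    .of_bound ((hDm n).mono (F.le _) le_rfl).aestronglyMeasurable 1 (hD n)
  let Y : Ω → ℝ := fun ω =>
    compensatedExp w D n ω * (Real.exp (-(w n ω ^ 2 / 2)) * Real.sinh (w n ω))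
  have hYm : StronglyMeasurable[F n] Y := Measurable.stronglyMeasurable <| (hmeas n).mul <|
    (Real.measurable_exp.comp (((hwm n).pow_const 2).div_const 2).neg).mul
      (Real.continuous_sinh.measurable.comp (hwm n))
  have hYb : ∀ᵐ ω ∂μ, ‖Y ω‖ ≤ Real.exp (n * B) := by
    filter_upwards [hbdd n] with ω hω
    rw [norm_mul]
    exact (mul_le_of_le_one_right (norm_nonneg _) (abs_exp_neg_half_sq_mul_sinh_le_one _)).trans hω
  have hYD : Integrable (Y * D n) μ := hDi.bdd_mul (hYm.mono (F.le n)).aestronglyMeasurable hYb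
  have hstep : compensatedExp w D (n + 1) ≤ᵐ[μ] compensatedExp w D n + Y * D n := by
    filter_upwards [hD n] with ω hω using compensatedExp_succ_le w D n hω
  filter_upwards [condExp_mono (m := F n) (hint (n + 1)) ((hint n).add hYD) hstep,
    condExp_add (hint n) hYD (F n),
    condExp_mul_eq_zero_of_condExp_eq_zero (F.le n) hDi (hD₀ n) hYm hYb] with ω h₁ h₂ h₃
  rw [condExp_of_stronglyMeasurable (F.le n) (hmeas n).stronglyMeasurable (hint n)] at h₂
  simpa only [h₂, Pi.add_apply, h₃, Pi.zero_apply, add_zero] using h₁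

theorem measureReal_le_sum_mul_le {B V c : ℝ} (hwm : ∀ k, Measurable[F k] (w k))
    (hw : ∀ k ω, |w k ω| ≤ B) (hDm : ∀ k, Measurable[F (k + 1)] (D k))
    (hD : ∀ k, ∀ᵐ ω ∂μ, |D k ω| ≤ 1) (hD₀ : ∀ k, μ[D k | F k] =ᵐ[μ] 0) {n : ℕ} (hV : 0 < V)
    (hwV : ∀ ω, ∑ k ∈ range n, w k ω ^ 2 ≤ V) (hc : 0 ≤ c) :
    μ.real {ω | c ≤ ∑ k ∈ range n, w k ω * D k ω} ≤ Real.exp (-(c ^ 2 / (2 * V))) := by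
  set s : ℝ := c / V
  have hs : 0 ≤ s := div_nonneg hc hV.le
  have hZ : Supermartingale (compensatedExp (fun k ω => s * w k ω) D) F μ :=
    supermartingale_compensatedExp (B := s * B) (fun k => (hwm k).const_mul s)
      (fun k ω => by rw [abs_mul, abs_of_nonneg hs]; gcongr; exact hw k ω) hDm hD hD₀
  have hsub : {ω | c ≤ ∑ k ∈ range n, w k ω * D k ω} ⊆
      {ω | Real.exp (c ^ 2 / (2 * V)) ≤ compensatedExp (fun k ω => s * w k ω) D n ω} := by
    intro ω (hω : c ≤ ∑ k ∈ range n, w k ω * D k ω)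
    refine Real.exp_le_exp.2 ?_
    calc c ^ 2 / (2 * V) = s * c - s ^ 2 / 2 * V := by simp only [s]; field_simp; ring
      _ ≤ s * ∑ k ∈ range n, w k ω * D k ω - s ^ 2 / 2 * ∑ k ∈ range n, w k ω ^ 2 := by
          gcongr
          exact hwV ω
      _ = ∑ k ∈ range n, (s * w k ω * D k ω - (s * w k ω) ^ 2 / 2) := by
          simp only [mul_sum, ← sum_sub_distrib]
          exact sum_congr rfl fun k _ => by ring
  have hint : ∫ ω, compensatedExp (fun k ω => s * w k ω) D n ω ∂μ ≤ 1 := by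
    simpa [compensatedExp] using hZ.setIntegral_le (zero_le (a := n)) MeasurableSet.univ
  have markov := mul_meas_ge_le_integral_of_nonneg
    (.of_forall fun ω => (compensatedExp_pos (fun k ω => s * w k ω) D n ω).le)
    (hZ.integrable n) (Real.exp (c ^ 2 / (2 * V)))
  rw [Real.exp_neg, ← one_div, le_div_iff₀' (Real.exp_pos _)]
  grw [measureReal_mono hsub, markov, hint]

theorem measureReal_le_sum_mul_le_of_equiv {S : Type*} [Fintype S] {n : ℕ} (e : S ≃ Fin n)
    {w D : S → Ω → ℝ} {V c : ℝ} (hwm : ∀ s, Measurable[F (e s)] (w s))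
    (hDm : ∀ s, Measurable[F (e s + 1)] (D s)) (hD : ∀ s, ∀ᵐ ω ∂μ, |D s ω| ≤ 1)
    (hD₀ : ∀ s, μ[D s | F (e s)] =ᵐ[μ] 0) (hV : 0 < V) (hwV : ∀ ω, ∑ s, w s ω ^ 2 ≤ V)
    (hc : 0 ≤ c) :
    μ.real {ω | c ≤ ∑ s, w s ω * D s ω} ≤ Real.exp (-(c ^ 2 / (2 * V))) := by
  let extend (f : S → Ω → ℝ) (k : ℕ) : Ω → ℝ := if h : k < n then f (e.symm ⟨k, h⟩) else 0
  have extend_of_lt (f) {k : ℕ} (h : k < n) : extend f k = f (e.symm ⟨k, h⟩) := dif_pos h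
  have extend_of_not_lt (f) {k : ℕ} (h : ¬k < n) : extend f k = 0 := dif_neg h
  have sum_extend (g : ℝ → ℝ → ℝ) (ω : Ω) :
      ∑ k ∈ range n, g (extend w k ω) (extend D k ω) = ∑ s, g (w s ω) (D s ω) := by
    rw [← Fin.sum_univ_eq_sum_range (fun k => g (extend w k ω) (extend D k ω)),
      ← e.sum_comp]
    exact sum_congr rfl fun s _ => by simp [extend_of_lt]
  have extend_property {P : ℕ → (Ω → ℝ) → Prop} {f : S → Ω → ℝ} (hf : ∀ s, P (e s) (f s))
      (h₀ : ∀ k, P k 0) (k : ℕ) : P k (extend f k) := by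
    by_cases hk : k < n
    · simpa [extend_of_lt f hk] using hf (e.symm ⟨k, hk⟩)
    · exact extend_of_not_lt f hk ▸ h₀ k
  have hw (s : S) (ω : Ω) : |w s ω| ≤ √V := Real.abs_le_sqrt <|
    (single_le_sum (f := fun s => w s ω ^ 2) (fun _ _ => sq_nonneg _) (mem_univ s)).trans (hwV ω)
  have azuma := measureReal_le_sum_mul_le (μ := μ) (w := extend w) (D := extend D) (B := √V)
    (extend_property (P := fun k f => Measurable[F k] f) hwm fun _ => measurable_const)
    (extend_property (P := fun _ f => ∀ ω, |f ω| ≤ √V) hw fun _ _ => by simp)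
    (extend_property (P := fun k f => Measurable[F (k + 1)] f) hDm fun _ => measurable_const)
    (extend_property (P := fun _ f => ∀ᵐ ω ∂μ, |f ω| ≤ 1) hD fun _ => .of_forall (by simp))
    (extend_property (P := fun k f => μ[f | F k] =ᵐ[μ] 0) hD₀ fun k => by simp)
    (n := n) hV (fun ω => (sum_extend (fun x _ => x ^ 2) ω).trans_le (hwV ω)) hc
  simpa only [sum_extend (fun x y => x * y)] using azuma

theorem measureReal_le_sum_mul_sub_le {S : Type*} [Fintype S] {n : ℕ} (e : S ≃ Fin n)
    {w X M : S → Ω → ℝ} {V c : ℝ} (hwm : ∀ s, Measurable[F (e s)] (w s))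
    (hXm : ∀ s, Measurable[F (e s + 1)] (X s)) (hX : ∀ s ω, X s ω ∈ Set.Icc (0 : ℝ) 1)
    (hM : ∀ s, μ[X s | F (e s)] =ᵐ[μ] M s) (hV : 0 < V) (hwV : ∀ ω, ∑ s, w s ω ^ 2 ≤ V)
    (hc : 0 ≤ c) :
    μ.real {ω | c ≤ ∑ s, w s ω * (X s ω - M s ω)} ≤ Real.exp (-(c ^ 2 / (2 * V))) := by
  have hXm' (s : S) : Measurable (X s) := (hXm s).mono (F.le _) le_rfl
  have azuma := measureReal_le_sum_mul_le_of_equiv (μ := μ) e hwm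
    (D := fun s => X s - μ[X s | F (e s)])
    (fun s => (hXm s).sub <|
      stronglyMeasurable_condExp.measurable.mono (F.mono (Nat.le_succ _)) le_rfl)
    (fun s => by simpa using ae_abs_sub_condExp_le (F.le _) (hXm' s) (hX s))
    (fun s => condExp_sub_condExp_eq_zero (F.le _) (integrable_of_mem_Icc (hXm' s) (hX s)))
    hV hwV hc
  refine (measureReal_congr ?_).trans_le azuma
  filter_upwards [ae_all_iff.2 hM] with ω hω
  refine propext (iff_of_eq ?_)
  change (c ≤ _) = (c ≤ _)
  simp only [Pi.sub_apply, hω]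

theorem measureReal_le_abs_sum_mul_sub_le {S : Type*} [Fintype S] {n : ℕ} (e : S ≃ Fin n)
    {w X M : S → Ω → ℝ} {V c : ℝ} (hwm : ∀ s, Measurable[F (e s)] (w s))
    (hXm : ∀ s, Measurable[F (e s + 1)] (X s)) (hX : ∀ s ω, X s ω ∈ Set.Icc (0 : ℝ) 1)
    (hM : ∀ s, μ[X s | F (e s)] =ᵐ[μ] M s) (hV : 0 < V) (hwV : ∀ ω, ∑ s, w s ω ^ 2 ≤ V)
    (hc : 0 ≤ c) :
    μ.real {ω | c ≤ |∑ s, w s ω * (X s ω - M s ω)|} ≤ 2 * Real.exp (-(c ^ 2 / (2 * V))) := by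
  have upper := measureReal_le_sum_mul_sub_le e hwm hXm hX hM hV hwV hc
  have lower := measureReal_le_sum_mul_sub_le e (w := -w) (fun s => (hwm s).neg) hXm hX hM hV
    (fun ω => by simpa only [Pi.neg_apply, neg_sq] using hwV ω) hc
  simp only [Pi.neg_apply, neg_mul, sum_neg_distrib] at lower
  simp only [le_abs, Set.ofPred_or]
  grw [measureReal_union_le, upper, lower]
  exact (two_mul _).ge

end Concentration

section StdSimplex

variable {B : Type*} [Fintype B] {x : B → ℝ}

lemma sum_le_one_of_mem_stdSimplex (hx : x ∈ stdSimplex ℝ B) (K : Finset B) :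
    ∑ a ∈ K, x a ≤ 1 :=
  (sum_le_univ_sum_of_nonneg hx.1).trans_eq hx.2

lemma sum_mul_le_of_mem_stdSimplex (hx : x ∈ stdSimplex ℝ B) {f : B → ℝ} {c : ℝ}
    (hf : ∀ a, f a ≤ c) : ∑ a, x a * f a ≤ c := by
  calc ∑ a, x a * f a ≤ ∑ a, x a * c := by
        gcongr with a
        exacts [hx.1 a, hf a]
    _ = c := by rw [← sum_mul, hx.2, one_mul]

lemma le_sum_mul_of_mem_stdSimplex (hx : x ∈ stdSimplex ℝ B) {f : B → ℝ} {c : ℝ}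
    (hf : ∀ a, c ≤ f a) : c ≤ ∑ a, x a * f a := by
  calc c = ∑ a, x a * c := by rw [← sum_mul, hx.2, one_mul]
    _ ≤ ∑ a, x a * f a := by
        gcongr with a
        exacts [hx.1 a, hf a]

lemma sum_mul_mem_Icc_of_mem_stdSimplex (hx : x ∈ stdSimplex ℝ B) {f : B → ℝ} {c d : ℝ}
    (hf : ∀ a, f a ∈ Set.Icc c d) : ∑ a, x a * f a ∈ Set.Icc c d :=
  ⟨le_sum_mul_of_mem_stdSimplex hx fun a => (hf a).1,
    sum_mul_le_of_mem_stdSimplex hx fun a => (hf a).2⟩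

lemma exists_sum_mul_le_of_mem_stdSimplex (hx : x ∈ stdSimplex ℝ B) (f : B → ℝ) :
    ∃ a, ∑ b, x b * f b ≤ f a := by
  obtain ⟨a₀, -⟩ := exists_ne_zero_of_sum_ne_zero (hx.2.trans_ne one_ne_zero)
  obtain ⟨a, -, ha⟩ := exists_max_image univ f ⟨a₀, mem_univ a₀⟩
  exact ⟨a, sum_mul_le_of_mem_stdSimplex hx fun b => ha b (mem_univ b)⟩

lemma one_sub_card_mul_le_sum (hx : x ∈ stdSimplex ℝ B) {K : Finset B} {p : ℝ} (hp : 0 ≤ p)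
    (hK : ∀ a ∉ K, x a ≤ p) : 1 - Fintype.card B * p ≤ ∑ a ∈ K, x a := by
  classical
  have hcompl : ∑ a ∈ Kᶜ, x a ≤ Fintype.card B * p := by
    calc ∑ a ∈ Kᶜ, x a ≤ ∑ _a ∈ Kᶜ, p := sum_le_sum fun a ha => hK a (mem_compl.1 ha)
      _ = #Kᶜ * p := by rw [sum_const, nsmul_eq_mul]
      _ ≤ Fintype.card B * p := by gcongr; exact card_le_univ _
  linarith [sum_add_sum_compl K x, hx.2]

lemma pointMass_mem_stdSimplex {B : Type u} [Fintype B] (a : B) :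
    pointMass a ∈ stdSimplex ℝ B := by
  classical
  have : pointMass a = Pi.single a (1 : ℝ) := by
    funext b
    simp [pointMass, Pi.single_apply]
  exact this ▸ single_mem_stdSimplex ℝ a

end StdSimplex

section ProductLaws

lemma one_sub_sum_le_prod {ι : Type*} (s : Finset ι) {z : ι → ℝ} (h₀ : ∀ i ∈ s, 0 ≤ z i)
    (h₁ : ∀ i ∈ s, z i ≤ 1) : 1 - ∑ i ∈ s, (1 - z i) ≤ ∏ i ∈ s, z i := by
  classical
  induction s using Finset.induction_on with
  | empty => simp
  | insert i s hi ih =>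
    rw [forall_mem_insert] at h₀ h₁
    rw [sum_insert hi, prod_insert hi]
    have hS : 0 ≤ ∑ j ∈ s, (1 - z j) := sum_nonneg fun j hj => sub_nonneg.2 (h₁.2 j hj)
    nlinarith [mul_le_mul_of_nonneg_left (ih h₀.2 h₁.2) h₀.1]

variable {ι : Type*} [Fintype ι] [DecidableEq ι] {A : ι → Type*} [∀ i, Fintype (A i)]
  {x y : ∀ j, A j → ℝ} {f : (∀ j, A j) → ℝ}

/-- The expectation of `f` when the players draw their actions independently from `x`. -/
def expect (x : ∀ j, A j → ℝ) (f : (∀ j, A j) → ℝ) : ℝ := ∑ b, (∏ j, x j (b j)) * f b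

lemma prod_mem_stdSimplex (hx : ∀ j, x j ∈ stdSimplex ℝ (A j)) :
    (fun b => ∏ j, x j (b j)) ∈ stdSimplex ℝ (∀ j, A j) := by
  refine ⟨fun b => prod_nonneg fun j _ => (hx j).1 _, ?_⟩
  rw [← Fintype.prod_sum]
  exact prod_eq_one fun j _ => (hx j).2

lemma expect_sub (x : ∀ j, A j → ℝ) (f g : (∀ j, A j) → ℝ) :
    expect x (fun b => f b - g b) = expect x f - expect x g := by
  simp only [expect, mul_sub, sum_sub_distrib]

lemma expect_sum_mul {κ : Type*} [Fintype κ] (x : ∀ j, A j → ℝ) (c : κ → ℝ)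
    (f : κ → (∀ j, A j) → ℝ) :
    expect x (fun b => ∑ a, c a * f a b) = ∑ a, c a * expect x (f a) := by
  simp only [expect, mul_sum]
  rw [sum_comm]
  exact sum_congr rfl fun a _ => sum_congr rfl fun b _ => by ring

lemma expect_one_sub (hx : ∀ j, x j ∈ stdSimplex ℝ (A j)) (f : (∀ j, A j) → ℝ) :
    expect x (fun b => 1 - f b) = 1 - expect x f := by
  simp only [expect, mul_sub, mul_one, sum_sub_distrib, (prod_mem_stdSimplex hx).2]

lemma expect_pointMass {A : ι → Type u} [∀ i, Fintype (A i)] (c : ∀ j, A j)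
    (f : (∀ j, A j) → ℝ) : expect (fun j => pointMass (c j)) f = f c := by
  unfold expect
  rw [sum_eq_single c]
  · simp [pointMass]
  · intro b _ hb
    obtain ⟨j, hj⟩ := Function.ne_iff.1 hb
    rw [prod_eq_zero (mem_univ j) (by simp [pointMass, hj]), zero_mul]
  · simp

variable {K : ∀ j, Finset (A j)} {q : ℝ}

lemma one_sub_card_mul_le_sum_piFinset (hx : ∀ j, x j ∈ stdSimplex ℝ (A j))
    (hK : ∀ j, 1 - q ≤ ∑ a ∈ K j, x j a) :
    1 - Fintype.card ι * q ≤ ∑ b ∈ Fintype.piFinset K, ∏ j, x j (b j) := by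
  rw [← prod_univ_sum]
  calc 1 - Fintype.card ι * q ≤ 1 - ∑ j, (1 - ∑ a ∈ K j, x j a) := by
        have : ∑ j, (1 - ∑ a ∈ K j, x j a) ≤ Fintype.card ι • q :=
          sum_le_card_nsmul _ _ _ fun j _ => by linarith [hK j]
        rw [nsmul_eq_mul] at this
        linarith
    _ ≤ ∏ j, ∑ a ∈ K j, x j a := one_sub_sum_le_prod univ
        (fun j _ => sum_nonneg fun a _ => (hx j).1 a)
        fun j _ => sum_le_one_of_mem_stdSimplex (hx j) _

lemma mul_le_expect_of_le_on_piFinset (hx : ∀ j, x j ∈ stdSimplex ℝ (A j))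
    (hK : ∀ j, 1 - q ≤ ∑ a ∈ K j, x j a) {c : ℝ} (hc : 0 ≤ c) (hf : ∀ b, 0 ≤ f b)
    (hfc : ∀ b, (∀ j, b j ∈ K j) → c ≤ f b) : c * (1 - Fintype.card ι * q) ≤ expect x f := by
  have hx₀ := (prod_mem_stdSimplex hx).1
  calc c * (1 - Fintype.card ι * q) ≤ c * ∑ b ∈ Fintype.piFinset K, ∏ j, x j (b j) := by
        gcongr
        exact one_sub_card_mul_le_sum_piFinset hx hK
    _ = ∑ b ∈ Fintype.piFinset K, (∏ j, x j (b j)) * c := by rw [mul_comm, sum_mul]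
    _ ≤ ∑ b ∈ Fintype.piFinset K, (∏ j, x j (b j)) * f b := by
        gcongr with b hb
        exacts [hx₀ b, hfc b (Fintype.mem_piFinset.1 hb)]
    _ ≤ expect x f := sum_le_univ_sum_of_nonneg fun b => mul_nonneg (hx₀ b) (hf b)

lemma expect_sub_card_mul_le_sum_piFinset (hx : ∀ j, x j ∈ stdSimplex ℝ (A j))
    (hK : ∀ j, 1 - q ≤ ∑ a ∈ K j, x j a) (hf : ∀ b, f b ≤ 1) :
    expect x f - Fintype.card ι * q ≤ ∑ b ∈ Fintype.piFinset K, (∏ j, x j (b j)) * f b := by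
  classical
  have hx' := prod_mem_stdSimplex hx
  have hcompl : ∑ b ∈ (Fintype.piFinset K)ᶜ, (∏ j, x j (b j)) * f b ≤
      ∑ b ∈ (Fintype.piFinset K)ᶜ, ∏ j, x j (b j) := by
    gcongr with b
    exact mul_le_of_le_one_right (hx'.1 b) (hf b)
  linarith [one_sub_card_mul_le_sum_piFinset hx hK, hx'.2,
    sum_add_sum_compl (Fintype.piFinset K) fun b => ∏ j, x j (b j),
    sum_add_sum_compl (Fintype.piFinset K) fun b => (∏ j, x j (b j)) * f b,
    show expect x f = ∑ b, (∏ j, x j (b j)) * f b from rfl]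

lemma expect_sub_card_mul_le_expect (hx : ∀ j, x j ∈ stdSimplex ℝ (A j))
    (hy : ∀ j, y j ∈ stdSimplex ℝ (A j)) (hK : ∀ j, 1 - q ≤ ∑ a ∈ K j, x j a)
    (hxy : ∀ j, ∀ a ∈ K j, x j a ≤ y j a) (hf : ∀ b, f b ∈ Set.Icc (0 : ℝ) 1) :
    expect x f - Fintype.card ι * q ≤ expect y f := by
  calc expect x f - Fintype.card ι * q
      ≤ ∑ b ∈ Fintype.piFinset K, (∏ j, x j (b j)) * f b :=
        expect_sub_card_mul_le_sum_piFinset hx hK fun b => (hf b).2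
    _ ≤ ∑ b ∈ Fintype.piFinset K, (∏ j, y j (b j)) * f b := by
        gcongr with b hb j
        exacts [(hf b).1, fun j _ => (hx j).1 _, hxy j _ (Fintype.mem_piFinset.1 hb j)]
    _ ≤ expect y f := sum_le_univ_sum_of_nonneg fun b =>
        mul_nonneg ((prod_mem_stdSimplex hy).1 b) (hf b).1

lemma abs_expect_sub_expect_le (hx : ∀ j, x j ∈ stdSimplex ℝ (A j))
    (hy : ∀ j, y j ∈ stdSimplex ℝ (A j)) (hK : ∀ j, 1 - q ≤ ∑ a ∈ K j, x j a)
    (hxy : ∀ j, ∀ a ∈ K j, x j a ≤ y j a) (hf : ∀ b, f b ∈ Set.Icc (0 : ℝ) 1) :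
    |expect y f - expect x f| ≤ Fintype.card ι * q := by
  have lower := expect_sub_card_mul_le_expect hx hy hK hxy hf
  have upper := expect_sub_card_mul_le_expect hx hy hK hxy (f := fun b => 1 - f b)
    fun b => ⟨sub_nonneg.2 (hf b).2, sub_le_self _ (hf b).1⟩
  rw [expect_one_sub hx, expect_one_sub hy] at upper
  exact abs_le.2 ⟨by linarith, by linarith⟩

lemma sum_eq_sum_filter_sum_update {i : ι} [DecidableEq (A i)] (a : A i)
    (H : (∀ j, A j) → ℝ) : ∑ b, H b = ∑ b with b i = a, ∑ c, H (Function.update b i c) := by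
  rw [← sum_product']
  refine sum_bij' (fun b _ => (Function.update b i a, b i))
    (fun bc _ => Function.update bc.1 i bc.2) ?_ ?_ ?_ ?_ ?_
  · simp
  · simp
  · simp
  · rintro ⟨b, c⟩ h
    obtain rfl : b i = a := by simpa using h
    simp
  · simp

end ProductLaws

section ExplorationLaw

variable {N : ℕ} {A : Fin N → Type u}

lemma explorationLaw_eq [∀ i, DecidableEq (A i)] (x : ∀ j, A j → ℝ) (p : Σ i, A i)
    (b : ∀ j, A j) : explorationLaw x p b
      = if b p.1 = p.2 then ∏ j ∈ Finset.univ.erase p.1, x j (b j) else 0 := by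
  unfold explorationLaw
  congr

variable [∀ i, Fintype (A i)]

lemma sum_explorationLaw_mul {x : ∀ j, A j → ℝ} {p : Σ i, A i} (hx : ∑ a, x p.1 a = 1)
    (f : (∀ j, A j) → ℝ) :
    ∑ b, explorationLaw x p b * f b = expect x fun b => f (Function.update b p.1 p.2) := by
  classical
  have prod_update (b : ∀ j, A j) (c : A p.1) : ∏ j, x j (Function.update b p.1 c j)
      = x p.1 c * ∏ j ∈ univ.erase p.1, x j (b j) := by
    rw [← mul_prod_erase univ _ (mem_univ p.1), Function.update_self]
    congr 1
    exact prod_congr rfl fun j hj => by rw [Function.update_of_ne (ne_of_mem_erase hj)]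
  unfold expect
  rw [sum_eq_sum_filter_sum_update p.2 fun b => (∏ j, x j (b j)) * _, sum_filter]
  refine sum_congr rfl fun b _ => ?_
  rw [explorationLaw_eq]
  split_ifs with h
  · simp only [prod_update, Function.update_idem, ← sum_mul, hx, one_mul, ← h,
      Function.update_eq_self]
  · rw [zero_mul]

lemma sum_mul_expect_update {x : ∀ j, A j → ℝ} {i : Fin N} (hx : ∑ a, x i a = 1)
    (f : (∀ j, A j) → ℝ) :
    ∑ a, x i a * expect x (fun b => f (Function.update b i a)) = expect x f := by
  classical
  calc ∑ a, x i a * expect x (fun b => f (Function.update b i a))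
      = ∑ a, x i a * ∑ b, explorationLaw x ⟨i, a⟩ b * f b :=
        sum_congr rfl fun a _ => by rw [← sum_explorationLaw_mul (p := ⟨i, a⟩) hx]
    _ = ∑ b, (∑ a, x i a * explorationLaw x ⟨i, a⟩ b) * f b := by
        simp only [mul_sum, sum_mul, mul_assoc]
        exact sum_comm
    _ = expect x f := by
        refine sum_congr rfl fun b _ => ?_
        simp only [explorationLaw_eq, mul_ite, mul_zero, sum_ite_eq, mem_univ, if_true]
        rw [mul_prod_erase univ (fun j => x j (b j)) (mem_univ i)]

end ExplorationLaw

section Clipping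

variable {B : Type u} [Fintype B] {x : B → ℝ} {p : ℝ}

lemma clip_mem_stdSimplex (hx : x ∈ stdSimplex ℝ B) (hZ : 0 < ∑ b with p ≤ x b, x b) :
    clip p x ∈ stdSimplex ℝ B := by
  refine ⟨fun a => ?_, ?_⟩
  · unfold clip
    split_ifs
    exacts [le_rfl, div_nonneg (hx.1 a) hZ.le]
  · have clip_eq (a : B) :
        clip p x a = (if p ≤ x a then x a else 0) / ∑ b with p ≤ x b, x b := by
      unfold clip
      rcases lt_or_ge (x a) p with h | h
      · rw [if_pos h, if_neg h.not_ge, zero_div]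
      · rw [if_neg h.not_gt, if_pos h]
    simp only [clip_eq, ← sum_div, ← sum_filter, div_self hZ.ne']

lemma le_clip (hx : x ∈ stdSimplex ℝ B) {a : B} (ha₀ : 0 < x a) (ha : p ≤ x a) :
    x a ≤ clip p x a := by
  have hZ : 0 < ∑ b with p ≤ x b, x b :=
    sum_pos' (fun b _ => hx.1 b) ⟨a, mem_filter.2 ⟨mem_univ a, ha⟩, ha₀⟩
  rw [clip, if_neg ha.not_gt]
  exact le_div_self (hx.1 a) hZ (sum_le_one_of_mem_stdSimplex hx _)

lemma le_of_clip_ne_zero {a : B} (h : clip p x a ≠ 0) : p ≤ x a := by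
  contrapose! h
  rw [clip, if_pos h]

variable {ι : Type*} [Fintype ι] [DecidableEq ι] {A : ι → Type u} [∀ i, Fintype (A i)] {m : ℕ}

lemma abs_expect_clip_sub_expect_le {x : ∀ j, A j → ℝ} (hx : ∀ j, x j ∈ stdSimplex ℝ (A j))
    (hp : 0 < p) (hm : ∀ j, Fintype.card (A j) ≤ m) (hmp : m * p < 1) {f : (∀ j, A j) → ℝ}
    (hf : ∀ b, f b ∈ Set.Icc (0 : ℝ) 1) :
    |expect (fun j => clip p (x j)) f - expect x f| ≤ Fintype.card ι * (m * p) := by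
  have hmass (j : ι) : 1 - m * p ≤ ∑ a with p ≤ x j a, x j a := by
    refine le_trans ?_ (one_sub_card_mul_le_sum (hx j) hp.le fun a ha => ?_)
    · gcongr
      exact hm j
    · exact (not_le.1 fun h => ha (mem_filter.2 ⟨mem_univ a, h⟩)).le
  refine abs_expect_sub_expect_le hx
    (fun j => clip_mem_stdSimplex (hx j) (by linarith [hmass j])) hmass (fun j a ha => ?_) hf
  have ha := (mem_filter.1 ha).2
  exact le_clip (hx j) (hp.trans_le ha) ha

end Clipping

section Hedge

variable {B : Type u} [Fintype B]

lemma sum_mul_exp_le_of_mem_stdSimplex (η : ℝ) {θ v : B → ℝ} (hθ : θ ∈ stdSimplex ℝ B)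
    (hv : ∀ a, v a ∈ Set.Icc (0 : ℝ) 1) :
    ∑ a, θ a * Real.exp (η * v a) ≤ Real.exp (η * ∑ a, θ a * v a + η ^ 2 / 2) := by
  set c := ∑ a, θ a * v a with hc
  have hc01 : c ∈ Set.Icc (0 : ℝ) 1 := sum_mul_mem_Icc_of_mem_stdSimplex hθ hv
  calc ∑ a, θ a * Real.exp (η * v a)
      ≤ ∑ a, θ a * (Real.exp (η * c) * (Real.cosh η + (v a - c) * Real.sinh η)) := by
        refine sum_le_sum fun a _ => mul_le_mul_of_nonneg_left ?_ (hθ.1 a)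
        rw [show η * v a = η * c + η * (v a - c) by ring, Real.exp_add]
        gcongr
        exact exp_mul_le_cosh_add_mul_sinh η (abs_sub_le_of_nonneg_of_le
          (hv a).1 (hv a).2 hc01.1 hc01.2)
    _ = Real.exp (η * c) * (Real.cosh η * ∑ a, θ a
          + Real.sinh η * (∑ a, θ a * v a - c * ∑ a, θ a)) := by
        simp_rw [mul_sum, ← sum_sub_distrib, mul_sum,
          ← sum_add_distrib, mul_sum]
        exact sum_congr rfl fun a _ => by ring
    _ = Real.exp (η * c) * Real.cosh η := by rw [hθ.2, ← hc]; ring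
    _ ≤ Real.exp (η * c + η ^ 2 / 2) := by
        rw [Real.exp_add]; gcongr; exact Real.cosh_le_exp_half_sq η

/-- The mixed strategy of Hedge with learning rate `η` and cumulative payoffs `S`. -/
def softmax (η : ℝ) (S : B → ℝ) (a : B) : ℝ := Real.exp (η * S a) / ∑ b, Real.exp (η * S b)

/-- The potential of the analysis of Hedge, a smooth substitute for `max S`. The mean (rather than
the sum) of the exponentials makes it monotone in `η`, which allows varying learning rates. -/
def logPotential (η : ℝ) (S : B → ℝ) : ℝ :=
  Real.log (∑ a, (Fintype.card B : ℝ)⁻¹ * Real.exp (η * S a)) / η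

variable [Nonempty B]

lemma sum_exp_pos (S : B → ℝ) : 0 < ∑ b, Real.exp (S b) :=
  sum_pos (fun _ _ => Real.exp_pos _) univ_nonempty

lemma sum_card_inv_mul_exp_pos (S : B → ℝ) :
    0 < ∑ a, (Fintype.card B : ℝ)⁻¹ * Real.exp (S a) := by
  rw [← mul_sum]
  exact mul_pos (by positivity) (sum_exp_pos S)

lemma softmax_mem_stdSimplex (η : ℝ) (S : B → ℝ) : softmax η S ∈ stdSimplex ℝ B := by
  have h := sum_exp_pos fun b => η * S b
  refine ⟨fun a => div_nonneg (Real.exp_pos _).le h.le, ?_⟩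
  unfold softmax
  rw [← sum_div, div_self h.ne']

lemma softmax_le (η : ℝ) (S : B → ℝ) (a a' : B) :
    softmax η S a ≤ Real.exp (-(η * (S a' - S a))) := by
  unfold softmax
  rw [div_le_iff₀ (sum_exp_pos fun b => η * S b)]
  calc Real.exp (η * S a) = Real.exp (-(η * (S a' - S a))) * Real.exp (η * S a') := by
        rw [← Real.exp_add]; ring_nf
    _ ≤ _ := by
        gcongr
        exact single_le_sum (f := fun b => Real.exp (η * S b))
          (fun b _ => (Real.exp_pos _).le) (mem_univ a')

lemma logPotential_mono {η η' : ℝ} (h₀ : 0 < η') (h : η' ≤ η) (S : B → ℝ) :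
    logPotential η' S ≤ logPotential η S := by
  have hη : 0 < η := h₀.trans_le h
  unfold logPotential
  have hJ := Real.rpow_arith_mean_le_arith_mean_rpow univ (fun _ : B => (Fintype.card B : ℝ)⁻¹)
    (fun a => Real.exp (η' * S a)) (fun _ _ => by positivity) (by simp)
    (fun _ _ => (Real.exp_pos _).le) (p := η / η') ((one_le_div h₀).2 h)
  have he : ∀ a, Real.exp (η' * S a) ^ (η / η') = Real.exp (η * S a) := fun a => by
    rw [← Real.exp_mul]; congr 1; field_simp
  simp_rw [he] at hJ
  have hpos := sum_card_inv_mul_exp_pos fun a => η' * S a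
  have hl := Real.log_le_log (Real.rpow_pos_of_pos hpos _) hJ
  rw [Real.log_rpow hpos] at hl
  rw [le_div_iff₀ hη]
  calc _ = η / η' * Real.log (∑ a, (Fintype.card B : ℝ)⁻¹ * Real.exp (η' * S a)) := by ring
    _ ≤ _ := hl

lemma logPotential_le_one {η : ℝ} (hη : 0 < η) {S : B → ℝ} (hS : ∀ a, S a ≤ 1) :
    logPotential η S ≤ 1 := by
  unfold logPotential
  rw [div_le_one hη, Real.log_le_iff_le_exp (sum_card_inv_mul_exp_pos _)]
  calc _ ≤ ∑ _a : B, (Fintype.card B : ℝ)⁻¹ * Real.exp η := by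
        gcongr
        exact mul_le_of_le_one_right hη.le (hS _)
    _ = Real.exp η := by simp

lemma le_logPotential {η : ℝ} (hη : 0 < η) (S : B → ℝ) (a : B) :
    S a - Real.log (Fintype.card B) / η ≤ logPotential η S := by
  unfold logPotential
  rw [le_div_iff₀ hη, sub_mul, div_mul_cancel₀ _ hη.ne', mul_comm, ← mul_sum,
    Real.log_mul (by positivity) (sum_exp_pos _).ne', Real.log_inv]
  have : η * S a ≤ Real.log (∑ b, Real.exp (η * S b)) := by
    rw [Real.le_log_iff_exp_le (sum_exp_pos _)]
    exact single_le_sum (f := fun b => Real.exp (η * S b))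
      (fun b _ => (Real.exp_pos _).le) (mem_univ a)
  linarith

lemma sum_card_inv_mul_exp_mul_add (η : ℝ) (S v : B → ℝ) :
    ∑ a, (Fintype.card B : ℝ)⁻¹ * Real.exp (η * (S a + v a))
      = (∑ a, (Fintype.card B : ℝ)⁻¹ * Real.exp (η * S a))
        * ∑ a, softmax η S a * Real.exp (η * v a) := by
  have := sum_exp_pos fun b => η * S b
  have hfactor : ∀ a, Real.exp (η * (S a + v a))
      = (∑ b, Real.exp (η * S b)) * (softmax η S a * Real.exp (η * v a)) := fun a => by
    rw [softmax, mul_add, Real.exp_add]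
    field_simp
  simp_rw [hfactor, ← mul_sum]
  ring

lemma logPotential_add_le {η : ℝ} (hη : 0 < η) (S : B → ℝ) {v : B → ℝ}
    (hv : ∀ a, v a ∈ Set.Icc (0 : ℝ) 1) :
    logPotential η (fun a => S a + v a)
      ≤ logPotential η S + (∑ a, softmax η S a * v a + η / 2) := by
  have hS := sum_card_inv_mul_exp_pos fun a => η * S a
  have hpos : 0 < ∑ a, softmax η S a * Real.exp (η * v a) := by
    have h := sum_card_inv_mul_exp_pos fun a => η * (S a + v a)
    rw [sum_card_inv_mul_exp_mul_add] at h
    exact (mul_pos_iff_of_pos_left hS).1 h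
  unfold logPotential
  rw [sum_card_inv_mul_exp_mul_add, Real.log_mul hS.ne' hpos.ne', add_div]
  gcongr
  rw [div_le_iff₀ hη, Real.log_le_iff_le_exp hpos]
  convert sum_mul_exp_le_of_mem_stdSimplex η (softmax_mem_stdSimplex η S) hv using 2
  ring

lemma hedge_regret_le {η : ℕ → ℝ} (hη : ∀ t, 1 ≤ t → 0 < η t)
    (hanti : ∀ t, 1 ≤ t → η (t + 1) ≤ η t) {v θ : ℕ → B → ℝ}
    (hv : ∀ t a, v t a ∈ Set.Icc (0 : ℝ) 1)
    (hθ : ∀ t, 1 ≤ t → θ t = softmax (η t) fun a => ∑ τ ∈ range t, v τ a)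
    {T : ℕ} (hT : 1 ≤ T) (a : B) :
    ∑ τ ∈ range T, v τ a ≤ 1 + Real.log (Fintype.card B) / η T
      + ∑ t ∈ Ico 1 T, (∑ b, θ t b * v t b + η t / 2) := by
  have key : ∀ n, 1 ≤ n → logPotential (η n) (fun a => ∑ τ ∈ range n, v τ a)
      ≤ 1 + ∑ t ∈ Ico 1 n, (∑ b, θ t b * v t b + η t / 2) := by
    intro n hn
    induction n, hn using Nat.le_induction with
    | base =>
      simp only [range_one, sum_singleton, Ico_self, sum_empty, add_zero]
      exact logPotential_le_one (hη 1 le_rfl) fun a => (hv 0 a).2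
    | succ n hn ih =>
      rw [sum_Ico_succ_top hn]
      refine (logPotential_mono (hη _ (by omega)) (hanti n hn) _).trans ?_
      simp_rw [sum_range_succ]
      refine (logPotential_add_le (hη n hn) _ (hv n)).trans ?_
      rw [← hθ n hn]
      linarith
  have h₁ := key T hT
  have h₂ := le_logPotential (hη T hT) (fun a => ∑ τ ∈ range T, v τ a) a
  linarith

end Hedge

section LearningRate

lemma sum_one_div_sqrt_le (n : ℕ) : ∑ t ∈ range n, 1 / √((t : ℝ) + 1) ≤ 2 * √n := by
  induction n with
  | zero => simp
  | succ n ih =>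
    rw [sum_range_succ]
    push_cast
    have hb : 0 < √((n : ℝ) + 1) := Real.sqrt_pos.2 (by positivity)
    have hb2 := Real.sq_sqrt (show (0 : ℝ) ≤ (n : ℝ) + 1 by positivity)
    have ha2 := Real.sq_sqrt (show (0 : ℝ) ≤ (n : ℝ) by positivity)
    have : 1 / √((n : ℝ) + 1) ≤ 2 * (√((n : ℝ) + 1) - √n) := by
      rw [div_le_iff₀ hb]
      nlinarith [sq_nonneg (√((n : ℝ) + 1) - √n)]
    linarith

lemma sum_one_div_le (n : ℕ) : ∑ t ∈ range n, 1 / ((t : ℝ) + 1) ≤ 1 + Real.log n := by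
  have h := harmonic_le_one_add_log n
  simpa [harmonic] using h

variable {n m : ℕ} {ε Δ : ℝ}

lemma clipThreshold_pos (hn : 1 ≤ n) (hm : 1 ≤ m) (hε : 0 < ε) (hΔ : 0 < Δ) :
    0 < clipThreshold n m ε Δ := by
  unfold clipThreshold
  have : 0 < min ε Δ := lt_min hε hΔ
  have : (0 : ℝ) < n := by exact_mod_cast hn
  have : (0 : ℝ) < m := by exact_mod_cast hm
  positivity

lemma mul_clipThreshold (hn : 1 ≤ n) (hm : 1 ≤ m) :
    n * (m * clipThreshold n m ε Δ) = min ε Δ / 8 := by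
  unfold clipThreshold
  have : (0 : ℝ) < n := by exact_mod_cast hn
  have : (0 : ℝ) < m := by exact_mod_cast hm
  field_simp

lemma mul_clipThreshold_le (hn : 1 ≤ n) (hm : 1 ≤ m) (hε : 0 < ε) (hΔ : 0 < Δ) (hε1 : ε ≤ 1) :
    m * clipThreshold n m ε Δ ≤ 1 / 8 := by
  have h := mul_clipThreshold (ε := ε) (Δ := Δ) hn hm
  have h₁ : (1 : ℝ) ≤ n := by exact_mod_cast hn
  have h₂ : 0 ≤ m * clipThreshold n m ε Δ :=
    mul_nonneg (Nat.cast_nonneg _) (clipThreshold_pos hn hm hε hΔ).le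
  nlinarith [min_le_left ε Δ]

lemma clipThreshold_le (hn : 1 ≤ n) (hm : 1 ≤ m) (hε : 0 < ε) (hΔ : 0 < Δ) (hε1 : ε ≤ 1) :
    clipThreshold n m ε Δ ≤ 1 / 8 := by
  have h := mul_clipThreshold_le hn hm hε hΔ hε1
  have h₁ : (1 : ℝ) ≤ m := by exact_mod_cast hm
  nlinarith [clipThreshold_pos hn hm hε hΔ]

lemma log_one_div_clipThreshold_pos (hn : 1 ≤ n) (hm : 1 ≤ m) (hε : 0 < ε) (hΔ : 0 < Δ)
    (hε1 : ε ≤ 1) : 0 < Real.log (1 / clipThreshold n m ε Δ) := by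
  refine Real.log_pos ?_
  rw [lt_div_iff₀ (clipThreshold_pos hn hm hε hΔ)]
  linarith [clipThreshold_le hn hm hε hΔ hε1]

lemma learningRate_pos (hn : 1 ≤ n) (hm : 1 ≤ m) (hε : 0 < ε) (hΔ : 0 < Δ) (hε1 : ε ≤ 1)
    {t : ℕ} (ht : 1 ≤ t) : 0 < learningRate n m ε Δ t := by
  refine lt_max_of_lt_right ?_
  have := log_one_div_clipThreshold_pos hn hm hε hΔ hε1
  have : (0 : ℝ) < t := by exact_mod_cast ht
  positivity

lemma learningRate_succ_le (hn : 1 ≤ n) (hm : 1 ≤ m) (hε : 0 < ε) (hΔ : 0 < Δ) (hε1 : ε ≤ 1)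
    {t : ℕ} (ht : 1 ≤ t) : learningRate n m ε Δ (t + 1) ≤ learningRate n m ε Δ t := by
  have := log_one_div_clipThreshold_pos hn hm hε hΔ hε1
  have : (0 : ℝ) < t := by exact_mod_cast ht
  have : 0 ≤ Real.log m := Real.log_natCast_nonneg m
  unfold learningRate
  push_cast
  gcongr <;> linarith

lemma log_div_learningRate_le (hn : 1 ≤ n) (hm : 1 ≤ m) (hε : 0 < ε) (hΔ : 0 < Δ) (hε1 : ε ≤ 1)
    {t : ℕ} (ht : 1 ≤ t) : Real.log m / learningRate n m ε Δ t ≤ √(t * Real.log m) := by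
  have hp := learningRate_pos hn hm hε hΔ hε1 ht
  have : (0 : ℝ) < t := by exact_mod_cast ht
  have hlog : 0 ≤ Real.log m := Real.log_natCast_nonneg m
  rw [div_le_iff₀ hp]
  calc Real.log m = √(t * Real.log m) * √(Real.log m / t) := by
        rw [← Real.sqrt_mul (by positivity), show t * Real.log m * (Real.log m / t)
          = Real.log m ^ 2 by field_simp, Real.sqrt_sq hlog]
    _ ≤ _ := by gcongr; exact le_max_left _ _

lemma sum_learningRate_le (hn : 1 ≤ n) (hm : 1 ≤ m) (hε : 0 < ε) (hΔ : 0 < Δ) (hε1 : ε ≤ 1)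
    (T : ℕ) : ∑ t ∈ Ico 1 T, learningRate n m ε Δ t
      ≤ 2 * √(T * Real.log m)
        + 4 * Real.log (1 / clipThreshold n m ε Δ) / Δ * (1 + Real.log T) := by
  have := log_one_div_clipThreshold_pos hn hm hε hΔ hε1
  have hlog : 0 ≤ Real.log m := Real.log_natCast_nonneg m
  have hle : ∑ t ∈ Ico 1 T, learningRate n m ε Δ t
      ≤ ∑ t ∈ range T, learningRate n m ε Δ (t + 1) := by
    rw [sum_Ico_eq_sum_range]
    simp_rw [add_comm 1]
    refine sum_le_sum_of_subset_of_nonneg (range_subset_range.2 (by omega)) ?_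
    intro t _ _
    exact (learningRate_pos hn hm hε hΔ hε1 (by omega)).le
  refine hle.trans ?_
  calc _ ≤ ∑ t ∈ range T, (√(Real.log m) * (1 / √((t : ℝ) + 1))
        + 4 * Real.log (1 / clipThreshold n m ε Δ) / Δ * (1 / ((t : ℝ) + 1))) := by
        refine sum_le_sum fun t _ => ?_
        unfold learningRate
        push_cast
        refine (max_le_add_of_nonneg (Real.sqrt_nonneg _) (by positivity)).trans (le_of_eq ?_)
        rw [Real.sqrt_div hlog]
        field_simp
    _ ≤ √(Real.log m) * (2 * √T)
        + 4 * Real.log (1 / clipThreshold n m ε Δ) / Δ * (1 + Real.log T) := by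
        rw [sum_add_distrib, ← mul_sum, ← mul_sum]
        gcongr
        · exact sum_one_div_sqrt_le T
        · exact sum_one_div_le T
    _ = _ := by rw [Real.sqrt_mul (Nat.cast_nonneg T)]; ring

end LearningRate

section Elimination

variable {N : ℕ} {A : Fin N → Type u} [∀ i, Fintype (A i)]

/-- The expected payoff of player `p.1` when playing `p.2` against opponents who draw their actions
independently from `x`. -/
def Game.deviationPayoff (G : Game A) (x : ∀ j, A j → ℝ) (p : Σ i, A i) : ℝ :=
  expect x fun b => G.util p.1 (Function.update b p.1 p.2)

variable (G : Game A) (Δ : ℝ)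

lemma elim_subset_succ (l : ℕ) : elim G Δ l ⊆ elim G Δ (l + 1) := by
  induction l with
  | zero => exact Set.empty_subset _
  | succ l ih =>
    rintro p ⟨x, hx, h⟩
    exact ⟨x, hx, fun b hb => h b fun j hj hmem => hb j hj (ih hmem)⟩

lemma elimLength_spec :
    1 ≤ elimLength G Δ ∧ elim G Δ (elimLength G Δ + 1) = elim G Δ (elimLength G Δ) := by
  have hne : {l | 1 ≤ l ∧ elim G Δ (l + 1) = elim G Δ l}.Nonempty := by
    obtain ⟨n, hn⟩ := WellFoundedGT.monotone_chain_condition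
      (⟨elim G Δ, monotone_nat_of_le_succ (elim_subset_succ G Δ)⟩ : ℕ →o Set (Σ i, A i))
    have h₁ := hn (n + 1) (by omega)
    have h₂ := hn (n + 2) (by omega)
    exact ⟨n + 1, by omega, h₂.symm.trans h₁⟩
  exact Nat.sInf_mem hne

variable {G Δ}

lemma card_le_maxActions (j : Fin N) : Fintype.card (A j) ≤ maxActions A :=
  Finset.le_sup (f := fun i => Fintype.card (A i)) (mem_univ j)

lemma one_le_maxActions [∀ i, Nonempty (A i)] (hN : 1 ≤ N) : 1 ≤ maxActions A :=
  (Fintype.card_pos (α := A ⟨0, hN⟩)).trans_le (card_le_maxActions _)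

lemma exists_deviationPayoff_add_le_of_mem_elim_succ (hΔ : 0 ≤ Δ) {l : ℕ} {p : Σ i, A i}
    (hp : p ∈ elim G Δ (l + 1)) :
    ∃ y ∈ stdSimplex ℝ (A p.1), ∀ x : ∀ j, A j → ℝ, (∀ j, x j ∈ stdSimplex ℝ (A j)) →
      ∀ q, 0 ≤ q → (∀ c ∈ elim G Δ l, x c.1 c.2 ≤ q) →
        G.deviationPayoff x p + (Δ - (1 + Δ) * (N * (maxActions A * q)))
          ≤ ∑ a, y a * G.deviationPayoff x ⟨p.1, a⟩ := by
  classical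
  obtain ⟨y, hy, hdom⟩ := hp
  refine ⟨y, hy, fun x hx q hq hxq => ?_⟩
  set gain : (∀ j, A j) → ℝ := fun b => G.util p.1 (Function.update b p.1 p.2)
    - ∑ a, y a * G.util p.1 (Function.update b p.1 a) with hgain
  have hexpect : expect x gain
      = G.deviationPayoff x p - ∑ a, y a * G.deviationPayoff x ⟨p.1, a⟩ := by
    rw [hgain, expect_sub, expect_sum_mul]
    rfl
  have hgain_le_one : ∀ b, 0 ≤ 1 - gain b := fun b => by
    have h := sum_mul_mem_Icc_of_mem_stdSimplex hy fun a =>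
      G.util_mem p.1 (Function.update b p.1 a)
    linarith [h.1, (G.util_mem p.1 (Function.update b p.1 p.2)).2]
  have hmass : ∀ j, 1 - maxActions A * q
      ≤ ∑ a with j ≠ p.1 → (⟨j, a⟩ : Σ i, A i) ∉ elim G Δ l, x j a := fun j => by
    have hcard : (Fintype.card (A j) : ℝ) ≤ maxActions A := by
      exact_mod_cast card_le_maxActions j
    refine le_trans (by gcongr) (one_sub_card_mul_le_sum (hx j) hq fun a ha => hxq ⟨j, a⟩ ?_)
    simp only [mem_filter, mem_univ, true_and, Classical.not_imp, not_not] at ha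
    exact ha.2
  have key := mul_le_expect_of_le_on_piFinset hx hmass (c := 1 + Δ) (by linarith) hgain_le_one
    fun b hb => by linarith [hdom b fun j => by simpa using hb j]
  rw [expect_one_sub hx, hexpect, Fintype.card_fin] at key
  linarith

lemma notMem_elim_succ_of_forall_le {l : ℕ} {i : Fin N} {b : ∀ j, A j} {est : A i → ℝ}
    (hb : ∀ j, j ≠ i → (⟨j, b j⟩ : Σ i, A i) ∉ elim G Δ l)
    (hest : ∀ c, |est c - G.util i (Function.update b i c)| < Δ / 2) {a : A i}
    (ha : ∀ c, est c ≤ est a) : (⟨i, a⟩ : Σ i, A i) ∉ elim G Δ (l + 1) := by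
  rintro ⟨x, hx, hdom⟩
  obtain ⟨c, hc⟩ := exists_sum_mul_le_of_mem_stdSimplex hx
    fun c => G.util i (Function.update b i c)
  have h := hdom b hb
  dsimp only at h hc
  linarith [ha c, (abs_lt.1 (hest c)).1, (abs_lt.1 (hest a)).2]

lemma bestResponse_notMem_elim {prof : ℕ → ∀ j, A j} {est : Fin (elimLength G Δ) → (Σ i, A i) → ℝ}
    (hest : ∀ l p, |est l p - G.util p.1 (Function.update (prof l) p.1 p.2)| < Δ / 2)
    (hbest : ∀ l i a, est l ⟨i, a⟩ ≤ est l ⟨i, prof (l + 1) i⟩) {l : ℕ} (hl : l ≤ elimLength G Δ)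
    (i : Fin N) : (⟨i, prof l i⟩ : Σ i, A i) ∉ elim G Δ l := by
  induction l generalizing i with
  | zero => exact Set.notMem_empty _
  | succ l ih =>
    exact notMem_elim_succ_of_forall_le (fun j _ => ih (by omega) j)
      (fun c => hest ⟨l, hl⟩ ⟨i, c⟩) (hbest ⟨l, hl⟩ i)

end Elimination

section HedgeStrategies

variable {N : ℕ} {A : Fin N → Type u} [∀ i, Fintype (A i)] {G : Game A} {Δ δ : ℝ} {T : ℕ}

/-- The average payoff of `p` in Hedge round `t + 1`, and `0` after the last round. -/
def roundPayoff (r : Slot G Δ δ T → ℝ) (t : ℕ) (p : Σ i, A i) : ℝ :=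
  if h : t < T then hedgeAverage r ⟨t, h⟩ p else 0

lemma sum_filter_hedgeAverage (r : Slot G Δ δ T → ℝ) (n : ℕ) (p : Σ i, A i) :
    ∑ τ ∈ Finset.univ.filter (fun τ : Fin T => (τ : ℕ) < n), hedgeAverage r τ p
      = ∑ τ ∈ range n, roundPayoff r τ p := by
  have h : ∀ τ : Fin T, hedgeAverage r τ p = roundPayoff r τ p := fun τ => by
    simp [roundPayoff]
  simp_rw [h]
  rw [sum_filter, Fin.sum_univ_eq_sum_range (fun τ => if τ < n then roundPayoff r τ p else 0)
    T, ← sum_filter]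
  refine sum_subset (fun τ hτ => mem_range.2 (mem_filter.1 hτ).2) fun τ hτ hτ' => ?_
  have hτT : ¬τ < T := fun h => hτ' (mem_filter.2 ⟨mem_range.2 h, mem_range.1 hτ⟩)
  exact dif_neg hτT

lemma roundPayoff_mem_Icc {r : Slot G Δ δ T → ℝ} (hr : ∀ s, r s ∈ Set.Icc (0 : ℝ) 1) (t : ℕ)
    (p : Σ i, A i) : roundPayoff r t p ∈ Set.Icc (0 : ℝ) 1 := by
  unfold roundPayoff
  split_ifs with h
  · unfold hedgeAverage
    refine ⟨div_nonneg (sum_nonneg fun m _ => (hr _).1) (Nat.cast_nonneg _), ?_⟩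
    refine div_le_one_of_le₀ ?_ (Nat.cast_nonneg _)
    refine (sum_le_sum fun m _ => (hr _).2).trans ?_
    simp
  · simp

lemma hedge_zero (ε : ℝ) (astar : ∀ j, A j) (r : Slot G Δ δ T → ℝ) (i : Fin N) :
    hedge ε astar r 0 i = pointMass (astar i) := rfl

lemma hedge_succ (ε : ℝ) (astar : ∀ j, A j) (r : Slot G Δ δ T → ℝ) (t : ℕ) (i : Fin N) :
    hedge ε astar r (t + 1) i = softmax (learningRate N (maxActions A) ε Δ (t + 1))
      fun a => ∑ τ ∈ range (t + 1), roundPayoff r τ ⟨i, a⟩ := by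
  funext a
  simp only [hedge, softmax, sum_filter_hedgeAverage]

lemma hedge_mem_stdSimplex [∀ i, Nonempty (A i)] (ε : ℝ) (astar : ∀ j, A j)
    (r : Slot G Δ δ T → ℝ) (t : ℕ) (i : Fin N) :
    hedge ε astar r t i ∈ stdSimplex ℝ (A i) := by
  cases t with
  | zero => exact pointMass_mem_stdSimplex _
  | succ t => rw [hedge_succ]; exact softmax_mem_stdSimplex _ _

variable [∀ i, Nonempty (A i)] {ε : ℝ} {astar : ∀ j, A j} {r : Slot G Δ δ T → ℝ}

lemma exists_sum_roundPayoff_gap (hN : 1 ≤ N) (hε : 0 < ε) (hΔ : 0 < Δ) (hΔ1 : Δ ≤ 1) {n : ℕ}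
    (hacc : ∀ p, |∑ τ ∈ range n,
      (roundPayoff r τ p - G.deviationPayoff (hedge ε astar r τ) p)| < n * (Δ / 4))
    (hle : ∀ τ < n, ∀ c ∈ elim G Δ (elimLength G Δ),
      hedge ε astar r τ c.1 c.2 ≤ clipThreshold N (maxActions A) ε Δ)
    {p : Σ i, A i} (hp : p ∈ elim G Δ (elimLength G Δ)) :
    ∃ a, n * (Δ / 4)
      < ∑ τ ∈ range n, roundPayoff r τ ⟨p.1, a⟩ - ∑ τ ∈ range n, roundPayoff r τ p := by
  have hm : 1 ≤ maxActions A := one_le_maxActions hN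
  have hq := clipThreshold_pos hN hm hε hΔ
  set payoff : ℕ → (Σ i, A i) → ℝ := fun τ => G.deviationPayoff (hedge ε astar r τ)
  rw [← (elimLength_spec G Δ).2] at hp
  obtain ⟨y, hy, hdom⟩ := exists_deviationPayoff_add_le_of_mem_elim_succ hΔ.le hp
  have hround : ∀ τ < n, payoff τ p + 3 / 4 * Δ ≤ ∑ a, y a * payoff τ ⟨p.1, a⟩ := fun τ hτ => by
    have h := hdom _ (hedge_mem_stdSimplex ε astar r τ) _ hq.le (hle τ hτ)
    rw [mul_clipThreshold hN hm] at h
    nlinarith [min_le_right ε Δ]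
  obtain ⟨a, ha⟩ := exists_sum_mul_le_of_mem_stdSimplex hy
    fun a => ∑ τ ∈ range n, payoff τ ⟨p.1, a⟩
  have hsum : ∑ τ ∈ range n, payoff τ p + n * (3 / 4 * Δ)
      ≤ ∑ τ ∈ range n, payoff τ ⟨p.1, a⟩ := by
    calc ∑ τ ∈ range n, payoff τ p + n * (3 / 4 * Δ)
        = ∑ τ ∈ range n, (payoff τ p + 3 / 4 * Δ) := by simp [sum_add_distrib]
      _ ≤ ∑ τ ∈ range n, ∑ a, y a * payoff τ ⟨p.1, a⟩ :=
          sum_le_sum fun τ hτ => hround τ (mem_range.1 hτ)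
      _ = ∑ a, y a * ∑ τ ∈ range n, payoff τ ⟨p.1, a⟩ := by
          rw [sum_comm]
          simp_rw [mul_sum]
      _ ≤ ∑ τ ∈ range n, payoff τ ⟨p.1, a⟩ := ha
  have hp_acc := (abs_lt.1 (hacc p)).2
  have ha_acc := (abs_lt.1 (hacc ⟨p.1, a⟩)).1
  rw [sum_sub_distrib] at hp_acc ha_acc
  exact ⟨a, by linarith⟩

lemma hedge_succ_lt_clipThreshold (hN : 1 ≤ N) (hε : 0 < ε) (hε1 : ε ≤ 1) (hΔ : 0 < Δ) {t : ℕ}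
    {i : Fin N} {a a' : A i}
    (hgap : ↑(t + 1) * (Δ / 4) < ∑ τ ∈ range (t + 1), roundPayoff r τ ⟨i, a'⟩
      - ∑ τ ∈ range (t + 1), roundPayoff r τ ⟨i, a⟩) :
    hedge ε astar r (t + 1) i a < clipThreshold N (maxActions A) ε Δ := by
  have hm : 1 ≤ maxActions A := one_le_maxActions hN
  have hη := learningRate_pos hN hm hε hΔ hε1 (t := t + 1) (by omega)
  have hη_le : 4 * Real.log (1 / clipThreshold N (maxActions A) ε Δ) / (Δ * ↑(t + 1))
      ≤ learningRate N (maxActions A) ε Δ (t + 1) := le_max_right _ _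
  rw [hedge_succ]
  refine (softmax_le _ _ a a').trans_lt ?_
  rw [← Real.lt_log_iff_exp_lt (clipThreshold_pos hN hm hε hΔ)]
  rw [div_le_iff₀ (by positivity), one_div, Real.log_inv] at hη_le
  linarith [mul_lt_mul_of_pos_left hgap hη]

lemma hedge_lt_clipThreshold (hN : 1 ≤ N) (hε : 0 < ε) (hε1 : ε ≤ 1) (hΔ : 0 < Δ) (hΔ1 : Δ ≤ 1)
    (hstar : ∀ i, Rationalizable G Δ i (astar i))
    (hacc : ∀ n, 1 ≤ n → n ≤ T → ∀ p, |∑ τ ∈ range n,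
      (roundPayoff r τ p - G.deviationPayoff (hedge ε astar r τ) p)| < n * (Δ / 4))
    {t : ℕ} (ht : t ≤ T) {p : Σ i, A i} (hp : p ∈ elim G Δ (elimLength G Δ)) :
    hedge ε astar r t p.1 p.2 < clipThreshold N (maxActions A) ε Δ := by
  induction t using Nat.strong_induction_on generalizing p with
  | _ t ih =>
    cases t with
    | zero =>
      have hne : p.2 ≠ astar p.1 := fun h => hstar p.1 (by rw [← h]; exact hp)
      rw [hedge_zero]
      simpa [pointMass, hne] using clipThreshold_pos hN (one_le_maxActions hN) hε hΔ
    | succ t =>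
      obtain ⟨a, ha⟩ := exists_sum_roundPayoff_gap hN hε hΔ hΔ1 (hacc (t + 1) (by omega) ht)
        (fun τ hτ c hc => (ih τ hτ (by omega) hc).le) hp
      exact hedge_succ_lt_clipThreshold hN hε hε1 hΔ ha

lemma hedge_estimated_regret_le (hN : 1 ≤ N) (hε : 0 < ε) (hε1 : ε ≤ 1) (hΔ : 0 < Δ)
    (hr : ∀ s, r s ∈ Set.Icc (0 : ℝ) 1) (hT : 1 ≤ T) (i : Fin N) (a : A i) :
    ∑ τ ∈ range T, roundPayoff r τ ⟨i, a⟩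
        - ∑ τ ∈ range T, ∑ b, hedge ε astar r τ i b * roundPayoff r τ ⟨i, b⟩
      ≤ 1 + 2 * √(T * Real.log (maxActions A))
        + 2 * Real.log (1 / clipThreshold N (maxActions A) ε Δ) / Δ * (1 + Real.log T) := by
  have hm : 1 ≤ maxActions A := one_le_maxActions hN
  have hregret := hedge_regret_le (η := learningRate N (maxActions A) ε Δ)
    (fun t => learningRate_pos hN hm hε hΔ hε1) (fun t => learningRate_succ_le hN hm hε hΔ hε1)
    (v := fun t a => roundPayoff r t ⟨i, a⟩) (θ := fun t => hedge ε astar r t i)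
    (fun t a => roundPayoff_mem_Icc hr t _)
    (fun t ht => by
      obtain ⟨s, rfl⟩ : ∃ s, t = s + 1 := ⟨t - 1, by omega⟩
      exact hedge_succ ..) hT a
  have hη := learningRate_pos hN hm hε hΔ hε1 hT
  have hlog : Real.log (Fintype.card (A i)) / learningRate N (maxActions A) ε Δ T
      ≤ √(T * Real.log (maxActions A)) := by
    refine le_trans ?_ (log_div_learningRate_le hN hm hε hΔ hε1 hT)
    gcongr
    exact card_le_maxActions i
  have hrates := sum_learningRate_le hN hm hε hΔ hε1 T
  have hfirst : ∑ t ∈ Ico 1 T, ∑ b, hedge ε astar r t i b * roundPayoff r t ⟨i, b⟩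
      ≤ ∑ τ ∈ range T, ∑ b, hedge ε astar r τ i b * roundPayoff r τ ⟨i, b⟩ := by
    refine sum_le_sum_of_subset_of_nonneg
      (fun t ht => mem_range.2 (mem_Ico.1 ht).2) fun t _ _ => ?_
    exact sum_nonneg fun b _ =>
      mul_nonneg ((hedge_mem_stdSimplex ε astar r t i).1 b) (roundPayoff_mem_Icc hr t _).1
  rw [sum_add_distrib, ← sum_div] at hregret
  linear_combination hregret + hlog + hrates / 2 + hfirst

end HedgeStrategies

section FiniteValued

lemma measurable_top_of_measurableSet_eq {Ω β : Type*} [Countable β] {m : MeasurableSpace Ω}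
    {X : Ω → β} (hX : ∀ b, MeasurableSet {ω | X ω = b}) : Measurable[m, ⊤] X :=
  letI : MeasurableSpace β := ⊤
  measurable_to_countable' hX

variable {Ω β : Type*} [Fintype β] {m mΩ : MeasurableSpace Ω} {μ : Measure Ω} [IsFiniteMeasure μ]

lemma condExp_comp_ae_eq_sum {X : Ω → β} (hX : ∀ b, MeasurableSet {ω | X ω = b}) (f : β → ℝ) :
    μ[fun ω => f (X ω) | m] =ᵐ[μ]
      fun ω => ∑ b, f b * (μ[{ω | X ω = b}.indicator fun _ => (1 : ℝ) | m]) ω := by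
  have hdecomp : (fun ω => f (X ω)) = ∑ b, f b • {ω | X ω = b}.indicator fun _ => (1 : ℝ) := by
    classical
    funext ω
    simp [Set.indicator_apply]
  have hint (b : β) : Integrable (f b • {ω | X ω = b}.indicator fun _ => (1 : ℝ)) μ :=
    ((integrable_const 1).indicator (hX b)).smul (f b)
  have hsmul (b : β) := condExp_smul (μ := μ) (f b) ({ω | X ω = b}.indicator fun _ => (1 : ℝ)) m
  filter_upwards [condExp_finsetSum (s := univ) (fun b _ => hint b) m, ae_all_iff.2 hsmul]
    with ω hsum hω
  rw [hdecomp, hsum, Finset.sum_apply]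
  simp only [hω, Pi.smul_apply, smul_eq_mul]

end FiniteValued

section SlotWeights

variable {N : ℕ} {A : Fin N → Type u} [∀ i, Fintype (A i)] {G : Game A} {Δ δ : ℝ} {T : ℕ}

lemma sum_slot (f : Slot G Δ δ T → ℝ) :
    ∑ s, f s = ∑ l, ∑ p, ∑ k, f (Sum.inl (l, p, k)) + ∑ t, ∑ p, ∑ k, f (Sum.inr ⟨t, p, k⟩) := by
  simp only [Fintype.sum_sum_type, Fintype.sum_prod_type, Fintype.sum_sigma]

open Classical in
/-- The weights of the plays in `initAverage`. -/
def initWeight (l : Fin (elimLength G Δ)) (p : Σ i, A i) : Slot G Δ δ T → ℝ :=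
  Sum.elim (fun x => if x.1 = l then if x.2.1 = p then
    (initBatchSize N (maxActions A) (elimLength G Δ) Δ δ : ℝ)⁻¹ else 0 else 0) fun _ => 0

lemma sum_initWeight_mul (l : Fin (elimLength G Δ)) (p : Σ i, A i) (f : Slot G Δ δ T → ℝ) :
    ∑ s, initWeight l p s * f s = initAverage f l p := by
  classical
  rw [sum_slot, initAverage, div_eq_inv_mul, mul_sum]
  simp only [initWeight, Sum.elim_inl, Sum.elim_inr, ite_mul, zero_mul, sum_const_zero, add_zero]
  rw [sum_eq_single l (fun l' _ h => by simp [h]) (by simp),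
    sum_eq_single p (fun p' _ h => by simp [h]) (by simp)]
  simp only [if_true]

lemma sum_initWeight_sq (l : Fin (elimLength G Δ)) (p : Σ i, A i)
    (hM : 0 < initBatchSize N (maxActions A) (elimLength G Δ) Δ δ) :
    ∑ s : Slot G Δ δ T, initWeight l p s ^ 2
      = (initBatchSize N (maxActions A) (elimLength G Δ) Δ δ : ℝ)⁻¹ := by
  simp only [sq, sum_initWeight_mul]
  simp [initAverage, initWeight, hM.ne']

/-- The weights of the plays in the combination `∑ t ∈ range n, ∑ p, a t p * roundPayoff r t p` of
the average payoffs of the Hedge rounds. -/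
def hedgeWeight (n : ℕ) (a : ℕ → (Σ i, A i) → ℝ) : Slot G Δ δ T → ℝ :=
  Sum.elim (fun _ => 0) fun x =>
    if (x.1 : ℕ) < n then a x.1 x.2.1 / batchSize N (maxActions A) Δ δ T (x.1 + 1) else 0

lemma sum_fin_ite_lt {n : ℕ} (hn : n ≤ T) (f : ℕ → ℝ) :
    ∑ t : Fin T, (if (t : ℕ) < n then f t else 0) = ∑ t ∈ range n, f t := by
  rw [Fin.sum_univ_eq_sum_range (fun t => if t < n then f t else 0), ← sum_filter]
  refine sum_congr ?_ fun _ _ => rfl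
  grind

lemma sum_hedgeWeight_mul {n : ℕ} (hn : n ≤ T) (a : ℕ → (Σ i, A i) → ℝ) (f : Slot G Δ δ T → ℝ) :
    ∑ s, hedgeWeight n a s * f s = ∑ t ∈ range n, ∑ p, a t p * roundPayoff f t p := by
  rw [sum_slot, ← sum_fin_ite_lt hn]
  simp only [hedgeWeight, Sum.elim_inl, Sum.elim_inr, zero_mul, sum_const_zero, zero_add]
  refine sum_congr rfl fun t _ => ?_
  split_ifs
  · refine sum_congr rfl fun p _ => ?_
    simp only [roundPayoff, t.is_lt, dif_pos, hedgeAverage, ← mul_sum]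
    ring
  · simp

lemma sum_hedgeWeight_sq {n : ℕ} (hn : n ≤ T) (a : ℕ → (Σ i, A i) → ℝ)
    (hM : ∀ t < n, 0 < batchSize N (maxActions A) Δ δ T (t + 1)) :
    ∑ s : Slot G Δ δ T, hedgeWeight n a s ^ 2
      = ∑ t ∈ range n, (∑ p, a t p ^ 2) / batchSize N (maxActions A) Δ δ T (t + 1) := by
  simp only [sq, sum_hedgeWeight_mul hn, sum_div]
  refine sum_congr rfl fun t ht => sum_congr rfl fun p _ => ?_
  have ht : t < n := mem_range.1 ht
  have hM := hM t ht
  simp only [roundPayoff, ht.trans_le hn, dif_pos, hedgeAverage, hedgeWeight, Sum.elim_inr, ht,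
    if_true, sum_const, card_univ, Fintype.card_fin, nsmul_eq_mul]
  field_simp

end SlotWeights

section RunConcentration

variable {N : ℕ} {A : Fin N → Type u} [∀ i, Fintype (A i)] {G : Game A} {ε Δ δ : ℝ} {T : ℕ}
  {Ω : Type v} [mΩ : MeasurableSpace Ω] {μ : Measure Ω}

/-- The payoff of the exploring player in play `s`. -/
def Run.payoff (R : Run G ε Δ δ T μ) (ω : Ω) (s : Slot G Δ δ T) : ℝ :=
  R.fb s ω (Slot.explored s).1

/-- The mixed strategies `θ^{(t+1)}` of the run. -/
def Run.strategy (R : Run G ε Δ δ T μ) (ω : Ω) (t : ℕ) : ∀ i, A i → ℝ :=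
  hedge ε (R.prof (elimLength G Δ) ω) (R.payoff ω) t

/-- The expected payoff of the exploring player in play `s`, given the past. -/
def Run.meanPayoff (R : Run G ε Δ δ T μ) (ω : Ω) (s : Slot G Δ δ T) : ℝ :=
  G.deviationPayoff (strategyAt ε (fun l => R.prof l ω) (R.payoff ω) s) (Slot.explored s)

/-- The estimation error for the payoff of `p` in best response round `l + 1`. -/
def Run.initError (R : Run G ε Δ δ T μ) (ω : Ω) (l : Fin (elimLength G Δ)) (p : Σ i, A i) : ℝ :=
  initAverage (R.payoff ω) l p - G.util p.1 (Function.update (R.prof l ω) p.1 p.2)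

/-- The estimation error for the expected payoff of `p` in Hedge round `t + 1`. -/
def Run.roundError (R : Run G ε Δ δ T μ) (ω : Ω) (t : ℕ) (p : Σ i, A i) : ℝ :=
  roundPayoff (R.payoff ω) t p - G.deviationPayoff (R.strategy ω t) p

variable (R : Run G ε Δ δ T μ)

lemma Run.measurable_payoff (s : Slot G Δ δ T) :
    Measurable[R.history ((R.time s : ℕ) + 1)] fun ω => R.payoff ω s := R.fb_adapted s _

lemma Run.measurable_prof (s : Slot G Δ δ T) {l : ℕ} (hl : l ≤ elimLength G Δ)
    (hls : l ≤ Slot.round s) : Measurable[R.history (R.time s), ⊤] (R.prof l) :=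
  measurable_top_of_measurableSet_eq (R.prof_adapted s l hl hls)

lemma Run.measurable_roundPayoff (s : Slot G Δ δ T) {t : ℕ} (ht : elimLength G Δ + t < s.round)
    (p : Σ i, A i) : Measurable[R.history (R.time s)] fun ω => roundPayoff (R.payoff ω) t p := by
  unfold roundPayoff
  split_ifs with h
  · refine (measurable_fun_sum univ fun k _ => ?_).div_const _
    exact (R.measurable_payoff _).mono
      (R.history.mono (R.time_lt (Sum.inr ⟨⟨t, h⟩, p, k⟩) s ht)) le_rfl
  · exact measurable_const

lemma Run.measurable_strategy (s : Slot G Δ δ T) {t : ℕ} (ht : elimLength G Δ + t ≤ s.round)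
    (i : Fin N) (a : A i) : Measurable[R.history (R.time s)] fun ω => R.strategy ω t i a := by
  unfold Run.strategy
  cases t with
  | zero =>
    simp only [hedge_zero]
    exact (measurable_from_top (f := fun b : ∀ j, A j => pointMass (b i) a)).comp
      (R.measurable_prof s le_rfl ht)
  | succ t =>
    have hexp (c : A i) : Measurable[R.history (R.time s)] fun ω =>
        Real.exp (learningRate N (maxActions A) ε Δ (t + 1)
          * ∑ τ ∈ range (t + 1), roundPayoff (R.payoff ω) τ ⟨i, c⟩) :=
      Real.measurable_exp.comp <| Measurable.const_mul (measurable_fun_sum _ fun τ hτ =>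
        R.measurable_roundPayoff s (by have := mem_range.1 hτ; omega) _) _
    simp only [hedge_succ, softmax]
    exact (hexp a).div (measurable_fun_sum _ fun c _ => hexp c)

lemma Run.sum_hedgeWeight_mul_payoff_sub (ω : Ω) {n : ℕ} (hn : n ≤ T)
    (hM : ∀ t < n, 0 < batchSize N (maxActions A) Δ δ T (t + 1)) (a : ℕ → (Σ i, A i) → ℝ) :
    ∑ s, hedgeWeight n a s * (R.payoff ω s - R.meanPayoff ω s)
      = ∑ t ∈ range n, ∑ p, a t p * R.roundError ω t p := by
  simp only [mul_sub, sum_sub_distrib, sum_hedgeWeight_mul hn, Run.roundError]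
  congr 1
  refine sum_congr rfl fun t ht => sum_congr rfl fun p _ => ?_
  have ht : t < n := mem_range.1 ht
  have hmean (k) : R.meanPayoff ω (Sum.inr ⟨⟨t, ht.trans_le hn⟩, p, k⟩)
      = G.deviationPayoff (R.strategy ω t) p := rfl
  simp [roundPayoff, ht.trans_le hn, hedgeAverage, hmean, (hM t ht).ne']

lemma Run.measurable_hedgeWeight {n : ℕ} {a : ℕ → (Σ i, A i) → Ω → ℝ}
    (ham : ∀ s t p, elimLength G Δ + t ≤ Slot.round s → Measurable[R.history (R.time s)] (a t p))
    (s : Slot G Δ δ T) :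
    Measurable[R.history (R.time s)] fun ω => hedgeWeight n (fun t p => a t p ω) s := by
  rcases s with x | ⟨t, p, k⟩
  · exact measurable_const
  · simp only [hedgeWeight, Sum.elim_inr]
    split_ifs
    · exact (ham (Sum.inr ⟨t, p, k⟩) t p le_rfl).div_const _
    · exact measurable_const

lemma strategyAt_mem_stdSimplex [∀ i, Nonempty (A i)] (prof : ℕ → ∀ j, A j)
    (r : Slot G Δ δ T → ℝ) (s : Slot G Δ δ T) (i : Fin N) :
    strategyAt ε prof r s i ∈ stdSimplex ℝ (A i) := by
  cases s with
  | inl x => exact pointMass_mem_stdSimplex _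
  | inr x => exact hedge_mem_stdSimplex _ _ _ _ _

variable [∀ i, Nonempty (A i)] [IsProbabilityMeasure μ]

lemma Run.condExp_payoff (s : Slot G Δ δ T) :
    μ[fun ω => R.payoff ω s | R.history (R.time s)] =ᵐ[μ] fun ω => R.meanPayoff ω s := by
  have hact (b : ∀ j, A j) : MeasurableSet {ω | R.act s ω = b} :=
    R.history.le _ _ (R.act_adapted s b)
  have htower := condExp_condExp_of_le (μ := μ) (f := fun ω => R.payoff ω s)
    (le_sup_left (b := MeasurableSpace.comap (R.act s) ⊤))
    (sup_le (R.history.le (R.time s)) (measurable_top_of_measurableSet_eq hact).comap_le)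
  filter_upwards [htower, condExp_congr_ae (m := R.history (R.time s)) (R.fb_mean s _),
    condExp_comp_ae_eq_sum (m := R.history (R.time s)) hact (G.util (Slot.explored s).1),
    ae_all_iff.2 (R.act_law s)] with ω htower hmean hsum hlaw
  rw [← htower, Run.meanPayoff, Game.deviationPayoff,
    ← sum_explorationLaw_mul (strategyAt_mem_stdSimplex _ _ _ _).2]
  refine (hmean.trans hsum).trans (sum_congr rfl fun b _ => ?_)
  rw [hlaw, mul_comm]
  rfl

lemma Run.measureReal_le_abs_initError_le (l : Fin (elimLength G Δ)) (p : Σ i, A i) {c : ℝ}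
    (hM : 0 < initBatchSize N (maxActions A) (elimLength G Δ) Δ δ) (hc : 0 ≤ c) :
    μ.real {ω | c ≤ |R.initError ω l p|} ≤ 2 * Real.exp
      (-(c ^ 2 * initBatchSize N (maxActions A) (elimLength G Δ) Δ δ / 2)) := by
  have hM' : (0 : ℝ) < initBatchSize N (maxActions A) (elimLength G Δ) Δ δ := by exact_mod_cast hM
  have azuma := measureReal_le_abs_sum_mul_sub_le (F := R.history) R.time
    (w := fun s _ => initWeight l p s) (V := (initBatchSize N (maxActions A) _ Δ δ : ℝ)⁻¹)
    (fun _ => measurable_const) R.measurable_payoff (fun _ _ => R.fb_mem _ _ _) R.condExp_payoff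
    (inv_pos.2 hM') (fun _ => (sum_initWeight_sq l p hM).le) hc
  have herror (ω : Ω) : ∑ s, initWeight l p s * (R.payoff ω s - R.meanPayoff ω s)
      = R.initError ω l p := by
    have hmean (k) : R.meanPayoff ω (Sum.inl (l, p, k))
        = G.util p.1 (Function.update (R.prof l ω) p.1 p.2) :=
      expect_pointMass (R.prof l ω) _
    simp only [mul_sub, sum_sub_distrib, sum_initWeight_mul, Run.initError]
    simp [initAverage, hmean, hM'.ne']
  simp only [herror] at azuma
  convert azuma using 3
  field_simp

lemma Run.measureReal_le_sum_roundError_le {n : ℕ} (hn : n ≤ T)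
    (hM : ∀ t < n, 0 < batchSize N (maxActions A) Δ δ T (t + 1)) {a : ℕ → (Σ i, A i) → Ω → ℝ}
    (ham : ∀ s t p, elimLength G Δ + t ≤ Slot.round s → Measurable[R.history (R.time s)] (a t p))
    {V c : ℝ} (hV : 0 < V) (haV : ∀ ω, ∑ t ∈ range n,
      (∑ p, a t p ω ^ 2) / batchSize N (maxActions A) Δ δ T (t + 1) ≤ V) (hc : 0 ≤ c) :
    μ.real {ω | c ≤ ∑ t ∈ range n, ∑ p, a t p ω * R.roundError ω t p}
      ≤ Real.exp (-(c ^ 2 / (2 * V))) := by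
  simpa only [R.sum_hedgeWeight_mul_payoff_sub _ hn hM] using
    measureReal_le_sum_mul_sub_le R.time (R.measurable_hedgeWeight ham) R.measurable_payoff
      (fun _ _ => R.fb_mem _ _ _) R.condExp_payoff hV
      (fun ω => (sum_hedgeWeight_sq hn _ hM).trans_le (haV ω)) hc

lemma Run.measureReal_le_abs_sum_roundError_le {n : ℕ} (hn : n ≤ T)
    (hM : ∀ t < n, 0 < batchSize N (maxActions A) Δ δ T (t + 1)) {a : ℕ → (Σ i, A i) → Ω → ℝ}
    (ham : ∀ s t p, elimLength G Δ + t ≤ Slot.round s → Measurable[R.history (R.time s)] (a t p))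
    {V c : ℝ} (hV : 0 < V) (haV : ∀ ω, ∑ t ∈ range n,
      (∑ p, a t p ω ^ 2) / batchSize N (maxActions A) Δ δ T (t + 1) ≤ V) (hc : 0 ≤ c) :
    μ.real {ω | c ≤ |∑ t ∈ range n, ∑ p, a t p ω * R.roundError ω t p|}
      ≤ 2 * Real.exp (-(c ^ 2 / (2 * V))) := by
  simpa only [R.sum_hedgeWeight_mul_payoff_sub _ hn hM] using
    measureReal_le_abs_sum_mul_sub_le R.time (R.measurable_hedgeWeight ham) R.measurable_payoff
      (fun _ _ => R.fb_mem _ _ _) R.condExp_payoff hV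
      (fun ω => (sum_hedgeWeight_sq hn _ hM).trans_le (haV ω)) hc

end RunConcentration

section Rounds

/-- The logarithm `ln (2 N A / (ε Δ δ))` in the number of rounds. -/
def logFactor (n m : ℕ) (ε Δ δ : ℝ) : ℝ := Real.log (2 * n * m / (ε * Δ * δ))

/-- The number `T₀` of Hedge rounds that suffices for the guarantees of the algorithm. -/
def numRounds (n m : ℕ) (ε Δ δ : ℝ) : ℕ :=
  ⌈1000 * logFactor n m ε Δ δ ^ 2 * (1 / ε ^ 2 + 1 / (ε * Δ))⌉₊

lemma le_numRounds (n m : ℕ) (ε Δ δ : ℝ) :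
    1000 * logFactor n m ε Δ δ ^ 2 * (1 / ε ^ 2 + 1 / (ε * Δ))
    ≤ numRounds n m ε Δ δ := Nat.le_ceil _

/-- The bound on what the estimation errors of `T` Hedge rounds contribute to the regret of a
player, valid for all deviations with probability at least `1 - δ`. -/
def regretTolerance (n m T : ℕ) (δ : ℝ) : ℝ := √(2 * T * Real.log (2 * (n * m) / δ))

/-- The ranges of the parameters of the algorithm: `n` players, at most `m` actions each, target
accuracies `ε` and `Δ`, and confidence parameter `δ`. -/
structure Admissible (n m : ℕ) (ε Δ δ : ℝ) : Prop where
  one_le_players : 1 ≤ n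
  one_le_actions : 1 ≤ m
  eps_pos : 0 < ε
  eps_le_one : ε ≤ 1
  gap_pos : 0 < Δ
  gap_le_one : Δ ≤ 1
  conf_pos : 0 < δ
  conf_lt_one : δ < 1

variable {n m : ℕ} {ε Δ δ : ℝ}

namespace Admissible

lemma one_le_mul (H : Admissible n m ε Δ δ) : (1 : ℝ) ≤ n * m := by
  exact_mod_cast Nat.mul_le_mul H.one_le_players H.one_le_actions

lemma log_le_logFactor (H : Admissible n m ε Δ δ)
    {x : ℝ} (hx : 0 < x) (h : x * (ε * Δ * δ) ≤ 2 * (n * m)) :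
    Real.log x ≤ logFactor n m ε Δ δ := by
  have := H.eps_pos
  have := H.gap_pos
  have := H.conf_pos
  refine Real.log_le_log hx ((le_div_iff₀ (by positivity)).2 ?_)
  linarith

lemma eps_mul_gap_le_one (H : Admissible n m ε Δ δ) :
    ε * Δ ≤ 1 := mul_le_one₀ H.eps_le_one H.gap_pos.le H.gap_le_one

lemma eps_mul_gap_mul_conf_le_one (H : Admissible n m ε Δ δ) : ε * Δ * δ ≤ 1 :=
  mul_le_one₀ H.eps_mul_gap_le_one H.conf_pos.le H.conf_lt_one.le

lemma log_two_le_logFactor (H : Admissible n m ε Δ δ) : Real.log 2 ≤ logFactor n m ε Δ δ :=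
  H.log_le_logFactor two_pos (by linarith [H.one_le_mul, H.eps_mul_gap_mul_conf_le_one])

lemma lt_logFactor (H : Admissible n m ε Δ δ) : 0.69 < logFactor n m ε Δ δ := by
  linarith [H.log_two_le_logFactor, Real.log_two_gt_d9]

lemma log_actions_le_logFactor (H : Admissible n m ε Δ δ) : Real.log m ≤ logFactor n m ε Δ δ := by
  have hm : (1 : ℝ) ≤ m := by exact_mod_cast H.one_le_actions
  have hn : (1 : ℝ) ≤ n := by exact_mod_cast H.one_le_players
  refine H.log_le_logFactor (by linarith) ?_
  nlinarith [H.eps_mul_gap_mul_conf_le_one]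

lemma log_div_conf_le_logFactor (H : Admissible n m ε Δ δ) :
    Real.log (2 * (n * m) / δ) ≤ logFactor n m ε Δ δ := by
  have h := H.one_le_mul
  have hδ := H.conf_pos
  refine H.log_le_logFactor (by positivity) ?_
  rw [show 2 * (n * m : ℝ) / δ * (ε * Δ * δ) = 2 * (n * m) * (ε * Δ) by field_simp]
  exact mul_le_of_le_one_right (by positivity) H.eps_mul_gap_le_one

lemma log_one_div_eps_mul_gap_le_logFactor (H : Admissible n m ε Δ δ) :
    Real.log (1 / (ε * Δ)) ≤ logFactor n m ε Δ δ := by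
  have := H.eps_pos
  have := H.gap_pos
  refine H.log_le_logFactor (by positivity) ?_
  rw [show 1 / (ε * Δ) * (ε * Δ * δ) = δ by field_simp]
  linarith [H.one_le_mul, H.conf_lt_one]

lemma log_logFactor_le (H : Admissible n m ε Δ δ) :
    Real.log (logFactor n m ε Δ δ) ≤ logFactor n m ε Δ δ := by
  have h := H.lt_logFactor
  linarith [Real.log_le_sub_one_of_pos (show 0 < logFactor n m ε Δ δ by linarith)]

lemma log_one_div_clipThreshold_le (H : Admissible n m ε Δ δ) :
    Real.log (1 / clipThreshold n m ε Δ) ≤ 3 * logFactor n m ε Δ δ := by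
  have := H.one_le_mul
  have hε := H.eps_pos
  have hΔ := H.gap_pos
  have := H.conf_pos
  have hp := clipThreshold_pos H.one_le_players H.one_le_actions hε hΔ
  have hmin : ε * Δ ≤ min ε Δ :=
    le_min (mul_le_of_le_one_right hε.le H.gap_le_one) (mul_le_of_le_one_left hΔ.le H.eps_le_one)
  have h4 : Real.log 4 = 2 * Real.log 2 := by
    rw [show (4 : ℝ) = 2 ^ 2 by norm_num, Real.log_pow]; norm_num
  have h : Real.log (1 / clipThreshold n m ε Δ / 4) ≤ logFactor n m ε Δ δ := by
    refine H.log_le_logFactor (by positivity) ?_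
    have hmul := mul_clipThreshold (ε := ε) (Δ := Δ) H.one_le_players H.one_le_actions
    rw [div_div, div_mul_eq_mul_div, one_mul, div_le_iff₀ (by positivity)]
    have : ε * Δ * δ ≤ ε * Δ := mul_le_of_le_one_right (by positivity) H.conf_lt_one.le
    nlinarith
  rw [Real.log_div (by positivity) (by norm_num)] at h
  linarith [H.log_two_le_logFactor]

lemma one_le_one_div_eps_sq (H : Admissible n m ε Δ δ) : 1 ≤ 1 / ε ^ 2 :=
  (one_le_div (pow_pos H.eps_pos 2)).2 (pow_le_one₀ H.eps_pos.le H.eps_le_one)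

lemma one_le_one_div_gap_sq (H : Admissible n m ε Δ δ) : 1 ≤ 1 / Δ ^ 2 :=
  (one_le_div (pow_pos H.gap_pos 2)).2 (pow_le_one₀ H.gap_pos.le H.gap_le_one)

lemma one_le_one_div_eps_mul_gap (H : Admissible n m ε Δ δ) : 1 ≤ 1 / (ε * Δ) :=
  (one_le_div (mul_pos H.eps_pos H.gap_pos)).2 H.eps_mul_gap_le_one

lemma numRounds_le (H : Admissible n m ε Δ δ) : (numRounds n m ε Δ δ : ℝ)
    ≤ 1002 * logFactor n m ε Δ δ ^ 2 * (1 / ε ^ 2 + 1 / (ε * Δ)) := by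
  have h₁ := H.one_le_one_div_eps_sq
  have h₂ := H.one_le_one_div_eps_mul_gap
  have h₃ : 0.47 ≤ logFactor n m ε Δ δ ^ 2 := by nlinarith [H.lt_logFactor]
  set Y := 1 / ε ^ 2 + 1 / (ε * Δ)
  have : 2 ≤ Y := by linarith
  have h := Nat.ceil_lt_add_one (R := ℝ)
    (show 0 ≤ 1000 * logFactor n m ε Δ δ ^ 2 * Y by positivity)
  change (numRounds n m ε Δ δ : ℝ) < _ at h
  nlinarith

lemma one_le_numRounds (H : Admissible n m ε Δ δ) : 1 ≤ numRounds n m ε Δ δ := by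
  have h₁ := H.one_le_one_div_eps_sq
  have h₂ := H.one_le_one_div_eps_mul_gap
  have h₃ : 0.47 ≤ logFactor n m ε Δ δ ^ 2 := by nlinarith [H.lt_logFactor]
  have : (1 : ℝ) ≤ numRounds n m ε Δ δ := le_trans (by nlinarith) (le_numRounds n m ε Δ δ)
  exact_mod_cast this

lemma mul_sq_logFactor_le (H : Admissible n m ε Δ δ) {T : ℕ} (hT : numRounds n m ε Δ δ ≤ T) :
    1000 * logFactor n m ε Δ δ ^ 2 ≤ ε ^ 2 * T := by
  have hε := H.eps_pos
  have hΔ := H.gap_pos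
  have hT' : 1000 * logFactor n m ε Δ δ ^ 2 * (1 / ε ^ 2 + 1 / (ε * Δ)) ≤ T :=
    (le_numRounds n m ε Δ δ).trans (by exact_mod_cast hT)
  have : 0 ≤ 1000 * logFactor n m ε Δ δ ^ 2 * (1 / (ε * Δ)) := by positivity
  have h : 1000 * logFactor n m ε Δ δ ^ 2 * (1 / ε ^ 2) ≤ T := by linarith
  rw [mul_one_div, div_le_iff₀ (by positivity)] at h
  linarith

lemma mul_sq_logFactor_div_gap_le (H : Admissible n m ε Δ δ) {T : ℕ}
    (hT : numRounds n m ε Δ δ ≤ T) : 1000 * logFactor n m ε Δ δ ^ 2 / Δ ≤ ε * T := by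
  have hε := H.eps_pos
  have hΔ := H.gap_pos
  have hT' : 1000 * logFactor n m ε Δ δ ^ 2 * (1 / ε ^ 2 + 1 / (ε * Δ)) ≤ T :=
    (le_numRounds n m ε Δ δ).trans (by exact_mod_cast hT)
  have : 0 ≤ 1000 * logFactor n m ε Δ δ ^ 2 * (1 / ε ^ 2) := by positivity
  have h : 1000 * logFactor n m ε Δ δ ^ 2 * (1 / (ε * Δ)) ≤ T := by linarith
  rw [mul_one_div, div_le_iff₀ (by positivity)] at h
  rw [div_le_iff₀ hΔ]
  linarith

lemma sqrt_mul_le (H : Admissible n m ε Δ δ) {T : ℕ} (hT : numRounds n m ε Δ δ ≤ T) {x : ℝ}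
    (hx : x ≤ 2 * logFactor n m ε Δ δ) : √(T * x) ≤ ε * T / 16 := by
  have hε := H.eps_pos
  have hx' : 256 * x ≤ ε ^ 2 * T := by nlinarith [H.mul_sq_logFactor_le hT, H.lt_logFactor]
  refine Real.sqrt_le_iff.2 ⟨by positivity, ?_⟩
  nlinarith [mul_le_mul_of_nonneg_left hx' (Nat.cast_nonneg (α := ℝ) T)]

/-- Since `log x ≤ x - 1`, dividing `T` by `64 Λ / (ε Δ)` before taking the logarithm makes the
linear term small enough to be absorbed by `ε T`. -/
lemma one_add_log_le (H : Admissible n m ε Δ δ) {T : ℕ} (hT : 1 ≤ T) :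
    1 + Real.log T ≤ 8 * logFactor n m ε Δ δ + ε * Δ * T / (64 * logFactor n m ε Δ δ) := by
  have hε := H.eps_pos
  have hΔ := H.gap_pos
  have hΛ : 0 < logFactor n m ε Δ δ := by linarith [H.lt_logFactor]
  have : (0 : ℝ) < T := by exact_mod_cast hT
  have h64 : Real.log 64 = 6 * Real.log 2 := by
    rw [show (64 : ℝ) = 2 ^ 6 by norm_num, Real.log_pow]; norm_num
  have hK : Real.log (64 * logFactor n m ε Δ δ * (1 / (ε * Δ))) ≤ 8 * logFactor n m ε Δ δ := by
    rw [Real.log_mul (by positivity) (by positivity), Real.log_mul (by norm_num) (by positivity),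
      h64]
    linarith [H.log_two_le_logFactor, H.log_logFactor_le, H.log_one_div_eps_mul_gap_le_logFactor]
  have h := Real.log_le_sub_one_of_pos
    (show 0 < T / (64 * logFactor n m ε Δ δ * (1 / (ε * Δ))) by positivity)
  rw [Real.log_div (by positivity) (by positivity)] at h
  have : T / (64 * logFactor n m ε Δ δ * (1 / (ε * Δ)))
      = ε * Δ * T / (64 * logFactor n m ε Δ δ) := by field_simp
  linarith

lemma one_add_log_clipThreshold_mul_le (H : Admissible n m ε Δ δ) {T : ℕ}
    (hT : numRounds n m ε Δ δ ≤ T) :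
    1 + 2 * Real.log (1 / clipThreshold n m ε Δ) / Δ * (1 + Real.log T) ≤ ε * T / 4 := by
  have hε := H.eps_pos
  have hΔ := H.gap_pos
  have hT1 : 1 ≤ T := H.one_le_numRounds.trans hT
  have hlogT : 0 ≤ Real.log T := Real.log_natCast_nonneg T
  have hlog := H.one_add_log_le hT1
  have hclip := H.log_one_div_clipThreshold_le
  have hT₂ := H.mul_sq_logFactor_div_gap_le hT
  have hΛ : 0.69 < logFactor n m ε Δ δ := H.lt_logFactor
  set Λ := logFactor n m ε Δ δ
  have hΛΔ : 1 ≤ 2 * Λ / Δ := by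
    rw [le_div_iff₀ hΔ]
    linarith [H.gap_le_one]
  calc _ ≤ 2 * Λ / Δ * (1 + Real.log T) + 2 * (3 * Λ) / Δ * (1 + Real.log T) := by
        gcongr
        nlinarith
    _ = 8 * Λ / Δ * (1 + Real.log T) := by ring
    _ ≤ 8 * Λ / Δ * (8 * Λ + ε * Δ * T / (64 * Λ)) := by gcongr
    _ = 64 / 1000 * (1000 * Λ ^ 2 / Δ) + ε * T / 8 := by field_simp; ring
    _ ≤ _ := by linarith [show 0 ≤ ε * T by positivity]

lemma regret_bound_le (H : Admissible n m ε Δ δ) {T : ℕ} (hT : numRounds n m ε Δ δ ≤ T) :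
    1 + 2 * √(T * Real.log m)
        + 2 * Real.log (1 / clipThreshold n m ε Δ) / Δ * (1 + Real.log T)
        + 2 * regretTolerance n m T δ ≤ ε / 2 * T := by
  have hΛ : 0.69 < logFactor n m ε Δ δ := H.lt_logFactor
  have hactions : √(T * Real.log m) ≤ ε * T / 16 :=
    H.sqrt_mul_le hT (by linarith [H.log_actions_le_logFactor])
  have htolerance : regretTolerance n m T δ ≤ ε * T / 16 := by
    rw [regretTolerance, mul_comm 2 (T : ℝ), mul_assoc]
    exact H.sqrt_mul_le hT (by linarith [H.log_div_conf_le_logFactor])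
  linarith [H.one_add_log_clipThreshold_mul_le hT]

lemma log_numRounds_le (H : Admissible n m ε Δ δ) :
    Real.log (numRounds n m ε Δ δ) ≤ 15 * logFactor n m ε Δ δ := by
  set Λ := logFactor n m ε Δ δ
  have hε := H.eps_pos
  have hΔ := H.gap_pos
  have hΛ0 : 0.69 < Λ := H.lt_logFactor
  have hT1 : (1 : ℝ) ≤ numRounds n m ε Δ δ := by exact_mod_cast H.one_le_numRounds
  have hz := H.one_le_one_div_eps_mul_gap
  have hle : (numRounds n m ε Δ δ : ℝ) ≤ 2 ^ 11 * (Λ ^ 2 * (1 / (ε * Δ)) ^ 2) := by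
    refine H.numRounds_le.trans ?_
    have h₁ : 1 / ε ^ 2 ≤ (1 / (ε * Δ)) ^ 2 := by
      rw [div_pow, one_pow, mul_pow]
      gcongr
      exact mul_le_of_le_one_right (by positivity) (pow_le_one₀ hΔ.le H.gap_le_one)
    have h₂ : 1 / (ε * Δ) ≤ (1 / (ε * Δ)) ^ 2 := le_self_pow₀ hz (by norm_num)
    have h₃ : 0 ≤ Λ ^ 2 * (1 / (ε * Δ)) ^ 2 := by positivity
    calc _ ≤ 1002 * Λ ^ 2 * ((1 / (ε * Δ)) ^ 2 + (1 / (ε * Δ)) ^ 2) := by gcongr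
      _ ≤ _ := by linarith
  refine (Real.log_le_log (by linarith) hle).trans ?_
  rw [Real.log_mul (by positivity) (by positivity), Real.log_mul (by positivity) (by positivity),
    Real.log_pow, Real.log_pow, Real.log_pow]
  push_cast
  linarith [H.log_two_le_logFactor, H.log_logFactor_le, H.log_one_div_eps_mul_gap_le_logFactor]

lemma one_lt_mul_div_conf (H : Admissible n m ε Δ δ)
    {T : ℕ} (hT : 1 ≤ T) : 1 < (m * n * T / δ : ℝ) := by
  rw [one_lt_div H.conf_pos]
  have : (1 : ℝ) ≤ T := by exact_mod_cast hT
  nlinarith [H.one_le_mul, H.conf_lt_one]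

lemma batchSize_pos (H : Admissible n m ε Δ δ)
    {T t : ℕ} (hT : 1 ≤ T) (ht : 1 ≤ t) : 0 < batchSize n m Δ δ T t := by
  have := Real.log_pos (H.one_lt_mul_div_conf hT)
  have := H.gap_pos
  have : (0 : ℝ) < t := by exact_mod_cast ht
  exact Nat.ceil_pos.2 (by positivity)

lemma one_div_batchSize_le (H : Admissible n m ε Δ δ) {T t : ℕ} (hT : 1 ≤ T) (ht : 1 ≤ t) :
    1 / (batchSize n m Δ δ T t : ℝ) ≤ Δ ^ 2 * t / (64 * Real.log (m * n * T / δ)) := by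
  have h₁ := Real.log_pos (H.one_lt_mul_div_conf hT)
  have h₂ := H.gap_pos
  have : (0 : ℝ) < t := by exact_mod_cast ht
  have h : 64 * Real.log (m * n * T / δ) / (Δ ^ 2 * t) ≤ batchSize n m Δ δ T t := Nat.le_ceil _
  have : 0 < 64 * Real.log (m * n * T / δ) / (Δ ^ 2 * t) := by positivity
  calc _ ≤ 1 / (64 * Real.log (m * n * T / δ) / (Δ ^ 2 * t)) := by gcongr
    _ = _ := one_div_div _ _

/-- The weights `1 / M_t` grow linearly in `t`, so a sum over `n` rounds has variance proxy
proportional to `n²`, which is what an error of order `n` requires. -/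
lemma sum_range_one_div_batchSize_le (H : Admissible n m ε Δ δ) {T k : ℕ} (hT : 1 ≤ T) :
    ∑ t ∈ range k, 1 / (batchSize n m Δ δ T (t + 1) : ℝ)
      ≤ Δ ^ 2 * k ^ 2 / (64 * Real.log (m * n * T / δ)) := by
  have := Real.log_pos (H.one_lt_mul_div_conf hT)
  calc _ ≤ ∑ _t ∈ range k, Δ ^ 2 * k / (64 * Real.log (m * n * T / δ)) := by
        refine sum_le_sum fun t ht => (H.one_div_batchSize_le hT (by omega)).trans ?_
        gcongr
        exact mem_range.1 ht
    _ = _ := by rw [sum_const, card_range, nsmul_eq_mul]; ring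

lemma sum_batchSize_le (H : Admissible n m ε Δ δ) {T : ℕ} (hT : 1 ≤ T) :
    ∑ t : Fin T, (batchSize n m Δ δ T (t + 1) : ℝ)
      ≤ T + 64 * Real.log (m * n * T / δ) / Δ ^ 2 * (1 + Real.log T) := by
  have h₁ := Real.log_pos (H.one_lt_mul_div_conf hT)
  have h₂ := H.gap_pos
  calc _ ≤ ∑ t : Fin T, (1 + 64 * Real.log (m * n * T / δ) / Δ ^ 2 * (1 / ((t : ℕ) + 1 : ℝ))) := by
        refine sum_le_sum fun t _ => ?_
        have h := (Nat.ceil_lt_add_one (R := ℝ)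
          (show 0 ≤ 64 * Real.log (m * n * T / δ) / (Δ ^ 2 * ((t : ℕ) + 1 : ℕ)) by positivity)).le
        refine h.trans (le_of_eq ?_)
        push_cast
        field_simp
        ring
    _ = T + 64 * Real.log (m * n * T / δ) / Δ ^ 2 * ∑ t ∈ range T, 1 / ((t : ℝ) + 1) := by
        rw [sum_add_distrib, ← mul_sum,
          Fin.sum_univ_eq_sum_range (fun t => 1 / ((t : ℝ) + 1)) T]
        simp
    _ ≤ _ := by
        gcongr
        exact sum_one_div_le T

lemma one_lt_length_mul_div_conf (H : Admissible n m ε Δ δ)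
    {L : ℕ} (hL : 1 ≤ L) : 1 < (L * n * m / δ : ℝ) := by
  rw [one_lt_div H.conf_pos]
  have : (1 : ℝ) ≤ L := by exact_mod_cast hL
  nlinarith [H.one_le_mul, H.conf_lt_one]

lemma initBatchSize_pos (H : Admissible n m ε Δ δ)
    {L : ℕ} (hL : 1 ≤ L) : 0 < initBatchSize n m L Δ δ := by
  have := Real.log_pos (H.one_lt_length_mul_div_conf hL)
  have := H.gap_pos
  exact Nat.ceil_pos.2 (by positivity)

lemma logFactor_le_log_mul_length (H : Admissible n m ε Δ δ) {L : ℕ} (hL : 1 ≤ L) :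
    logFactor n m ε Δ δ ≤ Real.log (2 * n * m * L / (ε * Δ * δ)) := by
  have hε := H.eps_pos
  have hΔ := H.gap_pos
  have hδ := H.conf_pos
  have hnm : (0 : ℝ) < 2 * n * m := by linarith [H.one_le_mul]
  refine Real.log_le_log (by positivity) (div_le_div_of_nonneg_right ?_ (by positivity))
  exact le_mul_of_one_le_right hnm.le (by exact_mod_cast hL)

lemma initBatchSize_le (H : Admissible n m ε Δ δ) {L : ℕ} (hL : 1 ≤ L) :
    (initBatchSize n m L Δ δ : ℝ)
      ≤ 132 * Real.log (2 * n * m * L / (ε * Δ * δ)) ^ 2 * (1 / Δ ^ 2) := by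
  have hε := H.eps_pos
  have hΔ := H.gap_pos
  have hδ := H.conf_pos
  have hlt := H.one_lt_length_mul_div_conf hL
  have hpos := Real.log_pos hlt
  have hlog : Real.log (L * n * m / δ) ≤ Real.log (2 * n * m * L / (ε * Δ * δ)) := by
    refine Real.log_le_log (by linarith) ?_
    rw [div_le_div_iff₀ hδ (by positivity)]
    have h₁ : (L * n * m : ℝ) * (ε * Δ * δ) ≤ (L * n * m) * δ := by
      gcongr
      exact mul_le_of_le_one_left hδ.le H.eps_mul_gap_le_one
    have h₂ : (0 : ℝ) ≤ L * n * m * δ := by positivity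
    linarith
  have : 0.69 < Real.log (2 * n * m * L / (ε * Δ * δ)) :=
    H.lt_logFactor.trans_le (H.logFactor_le_log_mul_length hL)
  set Λ := Real.log (2 * n * m * L / (ε * Δ * δ))
  calc (initBatchSize n m L Δ δ : ℝ) ≤ 64 * Real.log (L * n * m / δ) / Δ ^ 2 + 1 :=
        (Nat.ceil_lt_add_one (by positivity)).le
    _ ≤ 64 * Λ / Δ ^ 2 + 2 * Λ * (1 / Δ ^ 2) := by
        gcongr
        nlinarith [H.one_le_one_div_gap_sq]
    _ = 66 * Λ * (1 / Δ ^ 2) := by ring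
    _ ≤ _ := by
        gcongr ?_ * _
        nlinarith

lemma log_mul_numRounds_div_conf_le (H : Admissible n m ε Δ δ) :
    Real.log (m * n * numRounds n m ε Δ δ / δ) ≤ 16 * logFactor n m ε Δ δ := by
  have hT : (0 : ℝ) < numRounds n m ε Δ δ := by exact_mod_cast H.one_le_numRounds
  have hnm := H.one_le_mul
  have hpos : (0 : ℝ) < m * n / δ := div_pos (by linarith) H.conf_pos
  rw [mul_div_right_comm, Real.log_mul hpos.ne' hT.ne']
  have : Real.log (m * n / δ) ≤ Real.log (2 * (n * m) / δ) :=
    Real.log_le_log hpos (div_le_div_of_nonneg_right (by linarith) H.conf_pos.le)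
  linarith [H.log_div_conf_le_logFactor, H.log_numRounds_le]

lemma one_div_mul_le (H : Admissible n m ε Δ δ) : 1 / (ε * Δ) ≤ 1 / ε ^ 2 + 1 / Δ ^ 2 := by
  have hε := H.eps_pos
  have hΔ := H.gap_pos
  have : 1 / ε ^ 2 + 1 / Δ ^ 2 - 1 / (ε * Δ)
      = (1 / ε - 1 / Δ) ^ 2 / 2 + (1 / ε ^ 2 + 1 / Δ ^ 2) / 2 := by field_simp; ring
  have : 0 ≤ (1 / ε - 1 / Δ) ^ 2 / 2 + (1 / ε ^ 2 + 1 / Δ ^ 2) / 2 := by positivity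
  linarith

lemma sum_batchSize_numRounds_le (H : Admissible n m ε Δ δ) :
    ∑ t : Fin (numRounds n m ε Δ δ), (batchSize n m Δ δ (numRounds n m ε Δ δ) (t + 1) : ℝ)
      ≤ logFactor n m ε Δ δ ^ 2 * (2004 * (1 / ε ^ 2) + 18410 * (1 / Δ ^ 2)) := by
  have hΔ := H.gap_pos
  have hT := H.one_le_numRounds
  have hsum := H.sum_batchSize_le hT
  have hΛ : 0.69 < logFactor n m ε Δ δ := H.lt_logFactor
  have hlog := H.log_mul_numRounds_div_conf_le
  have hlogT := H.log_numRounds_le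
  have hlogT0 : 0 ≤ Real.log (numRounds n m ε Δ δ) := Real.log_natCast_nonneg _
  have hTle := H.numRounds_le
  have hinv := H.one_div_mul_le
  set T := numRounds n m ε Δ δ
  set Λ := logFactor n m ε Δ δ
  calc _ ≤ T + 64 * Real.log (m * n * T / δ) / Δ ^ 2 * (1 + Real.log T) := hsum
    _ ≤ 1002 * Λ ^ 2 * (1 / ε ^ 2 + (1 / ε ^ 2 + 1 / Δ ^ 2))
        + 64 * (16 * Λ) / Δ ^ 2 * (17 * Λ) := by
        gcongr
        · refine hTle.trans ?_
          gcongr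
        · linarith
    _ = _ := by ring

lemma plays_per_action_le (H : Admissible n m ε Δ δ) {L : ℕ} (hL : 1 ≤ L) :
    (L * initBatchSize n m L Δ δ : ℝ)
        + ∑ t : Fin (numRounds n m ε Δ δ), (batchSize n m Δ δ (numRounds n m ε Δ δ) (t + 1) : ℝ)
      ≤ 30000 * Real.log (2 * n * m * L / (ε * Δ * δ)) ^ 2 * (L / Δ ^ 2 + 1 / ε ^ 2) := by
  have hL' : (1 : ℝ) ≤ L := by exact_mod_cast hL
  have := H.lt_logFactor
  have hΛ := H.logFactor_le_log_mul_length hL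
  have hinit := H.initBatchSize_le hL
  have hbatch := H.sum_batchSize_numRounds_le
  set Λ := Real.log (2 * n * m * L / (ε * Δ * δ))
  have hgap : 1 / Δ ^ 2 ≤ L / Δ ^ 2 := by gcongr
  calc _ ≤ L * (132 * Λ ^ 2 * (1 / Δ ^ 2))
        + Λ ^ 2 * (2004 * (1 / ε ^ 2) + 18410 * (L / Δ ^ 2)) := by
        refine add_le_add (by gcongr) (hbatch.trans ?_)
        gcongr
    _ = Λ ^ 2 * (2004 * (1 / ε ^ 2) + 18542 * (L / Δ ^ 2)) := by ring
    _ ≤ Λ ^ 2 * (30000 * (1 / ε ^ 2) + 30000 * (L / Δ ^ 2)) := by gcongr <;> norm_num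
    _ = _ := by ring

end Admissible

end Rounds

section UnionBounds

variable {Ω : Type v} [MeasurableSpace Ω] {μ : Measure Ω}

lemma measureReal_exists_le {ι : Type*} [Fintype ι] {P : ι → Ω → Prop} {x : ℝ}
    (h : ∀ i, μ.real {ω | P i ω} ≤ x) : μ.real {ω | ∃ i, P i ω} ≤ Fintype.card ι * x := by
  rw [Set.ofPred_exists]
  calc _ ≤ ∑ i, μ.real {ω | P i ω} := measureReal_iUnion_fintype_le _
    _ ≤ ∑ _i : ι, x := sum_le_sum fun i _ => h i
    _ = _ := by rw [sum_const, card_univ, nsmul_eq_mul]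

lemma exp_neg_two_mul_log {x : ℝ} (hx : 0 < x) : Real.exp (-(2 * Real.log x)) = x⁻¹ ^ 2 := by
  rw [Real.exp_neg, mul_comm, Real.exp_mul, Real.exp_log hx, Real.rpow_two, inv_pow]

lemma mul_two_mul_div_sq_le {K δ : ℝ} (hK : 1 ≤ K) (hδ : 0 ≤ δ) (hδ2 : δ ≤ 1 / 2) :
    K * (2 * (δ / K) ^ 2) ≤ δ := by
  calc K * (2 * (δ / K) ^ 2) = 2 * δ ^ 2 / K := by field_simp
    _ ≤ 2 * δ ^ 2 / 1 := by gcongr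
    _ ≤ δ := by nlinarith

lemma card_sigma_le_mul_maxActions {N : ℕ} (A : Fin N → Type u) [∀ i, Fintype (A i)] :
    (Fintype.card (Σ i, A i) : ℝ) ≤ N * maxActions A := by
  rw [Fintype.card_sigma]
  push_cast
  calc ∑ i, (Fintype.card (A i) : ℝ) ≤ ∑ _i : Fin N, (maxActions A : ℝ) :=
        sum_le_sum fun i _ => by exact_mod_cast card_le_maxActions i
    _ = _ := by rw [sum_const, card_univ, Fintype.card_fin, nsmul_eq_mul]

end UnionBounds

section Events

variable {N : ℕ} {A : Fin N → Type u} [∀ i, Fintype (A i)] {G : Game A} {ε Δ δ : ℝ} {T : ℕ}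
  {Ω : Type v} [mΩ : MeasurableSpace Ω] {μ : Measure Ω}

/-- The event that some average of the best response phase is off by at least `Δ / 2`. -/
def Run.initFailure (R : Run G ε Δ δ T μ) : Set Ω :=
  {ω | ∃ x : Fin (elimLength G Δ) × (Σ i, A i), Δ / 2 ≤ |R.initError ω x.1 x.2|}

/-- The event that, for some `1 ≤ n ≤ T`, some cumulative estimate of the first `n` Hedge rounds is
off by at least `n Δ / 4`. The index `x.1` stands for `n - 1`. -/
def Run.estimateFailure (R : Run G ε Δ δ T μ) : Set Ω :=
  {ω | ∃ x : Fin T × (Σ i, A i),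
    (x.1 + 1 : ℕ) * (Δ / 4) ≤ |∑ t ∈ range (x.1 + 1), R.roundError ω t x.2|}

/-- The event that the estimation errors contribute at least `regretTolerance` to the regret of some
player against some action, through the estimates for that action or through the estimates for the
strategies played. -/
def Run.regretFailure (R : Run G ε Δ δ T μ) : Set Ω :=
  {ω | ∃ p : Σ i, A i,
    regretTolerance N (maxActions A) T δ ≤ -∑ t ∈ range T, R.roundError ω t p ∨
    regretTolerance N (maxActions A) T δ
      ≤ ∑ t ∈ range T, ∑ b, R.strategy ω t p.1 b * R.roundError ω t ⟨p.1, b⟩}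

variable [∀ i, Nonempty (A i)] [IsProbabilityMeasure μ] (R : Run G ε Δ δ T μ)
  (H : Admissible N (maxActions A) ε Δ δ)

include H

lemma Run.measureReal_half_le_abs_initError_le (l : Fin (elimLength G Δ)) (p : Σ i, A i) :
    μ.real {ω | Δ / 2 ≤ |R.initError ω l p|}
      ≤ 2 * (δ / (elimLength G Δ * N * maxActions A)) ^ 2 := by
  have hL := (elimLength_spec G Δ).1
  have hK := H.one_lt_length_mul_div_conf hL
  have hΔ := H.gap_pos
  have hM : 64 * Real.log (elimLength G Δ * N * maxActions A / δ) / Δ ^ 2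
      ≤ initBatchSize N (maxActions A) (elimLength G Δ) Δ δ := Nat.le_ceil _
  rw [div_le_iff₀ (by positivity)] at hM
  refine (R.measureReal_le_abs_initError_le l p (H.initBatchSize_pos hL) (by positivity)).trans ?_
  rw [← inv_div _ δ, ← exp_neg_two_mul_log (by linarith)]
  gcongr
  linarith [Real.log_pos hK]

lemma Run.measureReal_initFailure_le (hδ2 : δ ≤ 1 / 2) : μ.real R.initFailure ≤ δ := by
  have hL : (1 : ℝ) ≤ elimLength G Δ := by exact_mod_cast (elimLength_spec G Δ).1
  have hcard : (Fintype.card (Fin (elimLength G Δ) × (Σ i, A i)) : ℝ)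
      ≤ elimLength G Δ * N * maxActions A := by
    rw [Fintype.card_prod, Fintype.card_fin, mul_assoc]
    push_cast
    gcongr
    exact card_sigma_le_mul_maxActions A
  refine (measureReal_exists_le fun x : Fin (elimLength G Δ) × (Σ i, A i) =>
    R.measureReal_half_le_abs_initError_le H x.1 x.2).trans ?_
  refine (mul_le_mul_of_nonneg_right hcard (by positivity)).trans ?_
  refine mul_two_mul_div_sq_le ?_ H.conf_pos.le hδ2
  rw [mul_assoc]
  exact one_le_mul_of_one_le_of_one_le hL H.one_le_mul

lemma Run.measureReal_le_abs_sum_roundError_le_sq {n : ℕ} (hn : 1 ≤ n) (hnT : n ≤ T)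
    (p : Σ i, A i) :
    μ.real {ω | n * (Δ / 4) ≤ |∑ t ∈ range n, R.roundError ω t p|}
      ≤ 2 * (δ / (maxActions A * N * T)) ^ 2 := by
  classical
  have hT : 1 ≤ T := hn.trans hnT
  have hK := H.one_lt_mul_div_conf hT
  have hlog := Real.log_pos hK
  have hΔ := H.gap_pos
  have : (0 : ℝ) < n := by exact_mod_cast hn
  have azuma := R.measureReal_le_abs_sum_roundError_le hnT
    (a := fun _ q _ => if q = p then 1 else 0) (c := n * (Δ / 4))
    (V := Δ ^ 2 * n ^ 2 / (64 * Real.log (maxActions A * N * T / δ)))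
    (fun t _ => H.batchSize_pos hT (by omega)) (fun _ _ _ _ => measurable_const) (by positivity)
    (fun _ => by simpa using H.sum_range_one_div_batchSize_le hT) (by positivity)
  simp only [ite_mul, one_mul, zero_mul, sum_ite_eq', mem_univ, if_true] at azuma
  refine azuma.trans_eq ?_
  rw [← inv_div _ δ, ← exp_neg_two_mul_log (by linarith)]
  congr 3
  field_simp
  norm_num

lemma Run.measureReal_estimateFailure_le (hT : 1 ≤ T) (hδ2 : δ ≤ 1 / 2) :
    μ.real R.estimateFailure ≤ δ := by
  have hcard : (Fintype.card (Fin T × (Σ i, A i)) : ℝ) ≤ maxActions A * N * T := by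
    rw [Fintype.card_prod, Fintype.card_fin, mul_comm (maxActions A : ℝ), mul_comm]
    push_cast
    gcongr
    exact card_sigma_le_mul_maxActions A
  refine (measureReal_exists_le fun x : Fin T × (Σ i, A i) =>
    R.measureReal_le_abs_sum_roundError_le_sq H (by omega) x.1.2 x.2).trans ?_
  refine (mul_le_mul_of_nonneg_right hcard (by positivity)).trans ?_
  refine mul_two_mul_div_sq_le ?_ H.conf_pos.le hδ2
  rw [mul_comm (maxActions A : ℝ)]
  exact one_le_mul_of_one_le_of_one_le H.one_le_mul (by exact_mod_cast hT)

lemma Run.measureReal_regretTolerance_le (hT : 1 ≤ T) {a : ℕ → (Σ i, A i) → Ω → ℝ}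
    (ham : ∀ s t p, elimLength G Δ + t ≤ Slot.round s → Measurable[R.history (R.time s)] (a t p))
    (ha : ∀ t ω, ∑ p, a t p ω ^ 2 ≤ 1) :
    μ.real {ω | regretTolerance N (maxActions A) T δ
      ≤ ∑ t ∈ range T, ∑ p, a t p ω * R.roundError ω t p} ≤ δ / (2 * (N * maxActions A)) := by
  have hδ := H.conf_pos
  have hnm := H.one_le_mul
  have hT0 : (0 : ℝ) < T := by exact_mod_cast hT
  have hK : 1 < 2 * (N * maxActions A) / δ := by
    rw [one_lt_div hδ]
    linarith [H.conf_lt_one]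
  have hlog := Real.log_pos hK
  have hV (ω : Ω) : ∑ t ∈ range T,
      (∑ p, a t p ω ^ 2) / batchSize N (maxActions A) Δ δ T (t + 1) ≤ T := by
    calc _ ≤ ∑ _t ∈ range T, (1 : ℝ) := by
          refine sum_le_sum fun t _ => div_le_one_of_le₀ ((ha t ω).trans ?_) (Nat.cast_nonneg _)
          exact_mod_cast H.batchSize_pos hT (by omega)
      _ = T := by simp
  refine (R.measureReal_le_sum_roundError_le le_rfl (fun t _ => H.batchSize_pos hT (by omega)) ham
    hT0 hV (Real.sqrt_nonneg _)).trans_eq ?_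
  rw [Real.sq_sqrt (by positivity), mul_div_cancel_left₀ _ (by positivity),
    Real.exp_neg, Real.exp_log (by positivity), inv_div]

lemma Run.measureReal_regretTolerance_le_neg_sum_le (hT : 1 ≤ T) (p : Σ i, A i) :
    μ.real {ω | regretTolerance N (maxActions A) T δ ≤ -∑ t ∈ range T, R.roundError ω t p}
      ≤ δ / (2 * (N * maxActions A)) := by
  classical
  simpa using R.measureReal_regretTolerance_le H hT (a := fun _ q _ => if q = p then -1 else 0)
    (fun _ _ _ _ => measurable_const) fun _ _ => by simp [ite_pow]

lemma Run.measureReal_regretTolerance_le_sum_strategy_mul_le (hT : 1 ≤ T) (i : Fin N) :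
    μ.real {ω | regretTolerance N (maxActions A) T δ
      ≤ ∑ t ∈ range T, ∑ b, R.strategy ω t i b * R.roundError ω t ⟨i, b⟩}
      ≤ δ / (2 * (N * maxActions A)) := by
  have hsum (c f : (Σ j, A j) → ℝ) :
      ∑ q, (if q.1 = i then c q else 0) * f q = ∑ b, c ⟨i, b⟩ * f ⟨i, b⟩ := by
    rw [Fintype.sum_sigma, sum_eq_single i (fun j _ hj => by simp [hj]) (by simp)]
    simp
  have azuma := R.measureReal_regretTolerance_le H hT
    (a := fun t q ω => if q.1 = i then R.strategy ω t q.1 q.2 else 0)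
    (fun s t q ht => ?_) fun t ω => ?_
  · simpa only [hsum] using azuma
  · split_ifs
    · exact R.measurable_strategy s ht q.1 q.2
    · exact measurable_const
  · have hθ : R.strategy ω t i ∈ stdSimplex ℝ (A i) := hedge_mem_stdSimplex _ _ _ _ _
    simp only [sq, hsum, if_true]
    exact (sum_mul_mem_Icc_of_mem_stdSimplex hθ fun b => mem_Icc_of_mem_stdSimplex hθ b).2

lemma Run.measureReal_regretFailure_le (hT : 1 ≤ T) : μ.real R.regretFailure ≤ δ := by
  have hnm := H.one_le_mul
  have hδ := H.conf_pos
  refine (measureReal_exists_le (x := 2 * (δ / (2 * (N * maxActions A)))) fun p => ?_).trans ?_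
  · rw [Set.ofPred_or, two_mul]
    grw [measureReal_union_le]
    exact add_le_add (R.measureReal_regretTolerance_le_neg_sum_le H hT p)
      (R.measureReal_regretTolerance_le_sum_strategy_mul_le H hT p.1)
  · grw [card_sigma_le_mul_maxActions]
    rw [← mul_assoc, mul_comm _ (2 : ℝ), mul_div_cancel₀ _ (by linarith)]

end Events

section Output

variable {N : ℕ} {A : Fin N → Type u} [∀ i, Fintype (A i)] {G : Game A} {ε Δ δ : ℝ} {T : ℕ}

lemma sum_output_mul (astar : ∀ j, A j) (r : Slot G Δ δ T → ℝ) (f : (∀ j, A j) → ℝ) :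
    ∑ b, output ε astar r b * f b = (∑ t ∈ range T, expect
      (fun i => clip (clipThreshold N (maxActions A) ε Δ) (hedge ε astar r t i)) f) / T := by
  unfold output expect
  rw [sum_comm, sum_div]
  refine sum_congr rfl fun b _ => ?_
  rw [← sum_mul]
  ring

lemma output_playsRationalizable {astar : ∀ j, A j} {r : Slot G Δ δ T → ℝ}
    (h : ∀ t < T, ∀ p ∈ elim G Δ (elimLength G Δ),
      hedge ε astar r t p.1 p.2 < clipThreshold N (maxActions A) ε Δ) :
    PlaysRationalizable G Δ (output ε astar r) := by
  intro b hb i hmem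
  have hsum : ∑ t ∈ range T, ∏ i, clip (clipThreshold N (maxActions A) ε Δ)
      (hedge ε astar r t i) (b i) ≠ 0 := fun h0 => hb (by rw [output, h0, zero_div])
  obtain ⟨t, ht, hprod⟩ := exists_ne_zero_of_sum_ne_zero hsum
  have hi := prod_ne_zero_iff.1 hprod i (mem_univ i)
  exact absurd (h t (mem_range.1 ht) ⟨i, b i⟩ hmem) (not_lt.2 (le_of_clip_ne_zero hi))

variable [∀ i, Nonempty (A i)] (astar : ∀ j, A j) (r : Slot G Δ δ T → ℝ)
  (H : Admissible N (maxActions A) ε Δ δ)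

include H

lemma clip_hedge_mem_stdSimplex (t : ℕ) (i : Fin N) :
    clip (clipThreshold N (maxActions A) ε Δ) (hedge ε astar r t i) ∈ stdSimplex ℝ (A i) := by
  set q := clipThreshold N (maxActions A) ε Δ
  have hq : 0 ≤ q :=
    (clipThreshold_pos H.one_le_players H.one_le_actions H.eps_pos H.gap_pos).le
  have hmq : maxActions A * q ≤ 1 / 8 :=
    mul_clipThreshold_le H.one_le_players H.one_le_actions H.eps_pos H.gap_pos H.eps_le_one
  have hθ := hedge_mem_stdSimplex ε astar r t i
  have hkept := one_sub_card_mul_le_sum hθ (K := {a | q ≤ hedge ε astar r t i a}) hq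
    fun a ha => by simpa using (not_le.1 fun h => ha (mem_filter.2 ⟨mem_univ a, h⟩)).le
  have hcard : (Fintype.card (A i) : ℝ) ≤ maxActions A := by exact_mod_cast card_le_maxActions i
  exact clip_mem_stdSimplex hθ (by linarith [mul_le_mul_of_nonneg_right hcard hq])

lemma output_mem_stdSimplex (hT : 1 ≤ T) : output ε astar r ∈ stdSimplex ℝ (∀ j, A j) := by
  have hprod (t : ℕ) := prod_mem_stdSimplex (clip_hedge_mem_stdSimplex astar r H t)
  have hT0 : (T : ℝ) ≠ 0 := by positivity
  refine ⟨fun b => div_nonneg (sum_nonneg fun t _ => (hprod t).1 b) (Nat.cast_nonneg _), ?_⟩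
  have hsum := sum_output_mul (ε := ε) astar r fun _ => 1
  simp only [expect, mul_one, (hprod _).2, sum_const, card_range, nsmul_eq_mul] at hsum
  rw [hsum, div_self hT0]

lemma abs_expect_clip_hedge_sub_expect_hedge_le (t : ℕ) {f : (∀ j, A j) → ℝ}
    (hf : ∀ b, f b ∈ Set.Icc (0 : ℝ) 1) :
    |expect (fun j => clip (clipThreshold N (maxActions A) ε Δ) (hedge ε astar r t j)) f
      - expect (hedge ε astar r t) f| ≤ ε / 8 := by
  have hmq := mul_clipThreshold_le H.one_le_players H.one_le_actions H.eps_pos H.gap_pos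
    H.eps_le_one
  refine (abs_expect_clip_sub_expect_le (hedge_mem_stdSimplex ε astar r t)
    (clipThreshold_pos H.one_le_players H.one_le_actions H.eps_pos H.gap_pos) card_le_maxActions
    (by linarith) hf).trans ?_
  rw [Fintype.card_fin, mul_clipThreshold H.one_le_players H.one_le_actions]
  gcongr
  exact min_le_left ε Δ

variable {astar r} (hT : numRounds N (maxActions A) ε Δ δ ≤ T)
  (hr : ∀ s, r s ∈ Set.Icc (0 : ℝ) 1)
  (hdev : ∀ p, -∑ t ∈ range T, (roundPayoff r t p - G.deviationPayoff (hedge ε astar r t) p)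
    ≤ regretTolerance N (maxActions A) T δ)
  (hplay : ∀ i, ∑ t ∈ range T, ∑ b, hedge ε astar r t i b *
    (roundPayoff r t ⟨i, b⟩ - G.deviationPayoff (hedge ε astar r t) ⟨i, b⟩)
    ≤ regretTolerance N (maxActions A) T δ)

include hT hr hdev hplay

lemma hedge_regret_le_half_mul (i : Fin N) (a : A i) :
    ∑ t ∈ range T, expect (hedge ε astar r t) (fun b => G.util i (Function.update b i a))
      - ∑ t ∈ range T, expect (hedge ε astar r t) (G.util i) ≤ ε / 2 * T := by
  have hestimated := hedge_estimated_regret_le (astar := astar) H.one_le_players H.eps_pos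
    H.eps_le_one H.gap_pos hr (H.one_le_numRounds.trans hT) i a
  have hbound := H.regret_bound_le hT
  have hplayed (t : ℕ) : ∑ b, hedge ε astar r t i b *
      G.deviationPayoff (hedge ε astar r t) ⟨i, b⟩ = expect (hedge ε astar r t) (G.util i) :=
    sum_mul_expect_update (hedge_mem_stdSimplex ε astar r t i).2 (G.util i)
  have hdev_a := hdev ⟨i, a⟩
  have hplay_i := hplay i
  rw [sum_sub_distrib] at hdev_a
  simp only [mul_sub, sum_sub_distrib, hplayed] at hplay_i
  unfold Game.deviationPayoff at hdev_a
  linarith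

lemma output_isCCE : IsCCE G ε (output ε astar r) := by
  have hT1 : 1 ≤ T := H.one_le_numRounds.trans hT
  have hT0 : (0 : ℝ) < T := by exact_mod_cast hT1
  refine ⟨output_mem_stdSimplex astar r H hT1, fun i a => ?_⟩
  have hregret := hedge_regret_le_half_mul H hT hr hdev hplay i a
  have hdeviate := sum_le_sum fun t (_ : t ∈ range T) => (abs_sub_le_iff.1
    (abs_expect_clip_hedge_sub_expect_hedge_le astar r H t
      fun b => G.util_mem i (Function.update b i a))).1
  have hcomply := sum_le_sum fun t (_ : t ∈ range T) => (abs_sub_le_iff.1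
    (abs_expect_clip_hedge_sub_expect_hedge_le astar r H t (G.util_mem i))).2
  rw [sum_sub_distrib, sum_const, card_range, nsmul_eq_mul] at hdeviate hcomply
  rw [sum_output_mul, sum_output_mul, sub_le_iff_le_add, div_le_iff₀ hT0, add_mul,
    div_mul_cancel₀ _ hT0.ne']
  have := mul_pos H.eps_pos hT0
  linarith

end Output

section Main

variable {N : ℕ} {A : Fin N → Type u} [∀ i, Fintype (A i)] {G : Game A} {ε Δ δ : ℝ}

lemma sampleCount_eq (G : Game A) (Δ δ : ℝ) (T : ℕ) :
    (sampleCount G Δ δ T : ℝ) = Fintype.card (Σ i, A i) *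
      (elimLength G Δ * initBatchSize N (maxActions A) (elimLength G Δ) Δ δ
        + ∑ t : Fin T, (batchSize N (maxActions A) Δ δ T (t + 1) : ℝ)) := by
  simp only [sampleCount, Slot, Fintype.card_sum, Fintype.card_prod, Fintype.card_sigma,
    Fintype.card_fin]
  push_cast
  rw [← mul_sum]
  ring

theorem sampleCount_numRounds_le (G : Game A) (H : Admissible N (maxActions A) ε Δ δ) :
    (sampleCount G Δ δ (numRounds N (maxActions A) ε Δ δ) : ℝ)
      ≤ 30000 * Real.log (2 * N * maxActions A * elimLength G Δ / (ε * Δ * δ)) ^ 2 *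
        (elimLength G Δ * N * maxActions A / Δ ^ 2 + N * maxActions A / ε ^ 2) := by
  have hplays := H.plays_per_action_le (elimLength_spec G Δ).1
  rw [sampleCount_eq]
  calc _ ≤ (N * maxActions A : ℝ) * (30000 *
        Real.log (2 * N * maxActions A * elimLength G Δ / (ε * Δ * δ)) ^ 2 *
          (elimLength G Δ / Δ ^ 2 + 1 / ε ^ 2)) := by
        gcongr
        exact card_sigma_le_mul_maxActions A
    _ = _ := by ring

variable {T : ℕ} {Ω : Type v} [MeasurableSpace Ω] {μ : Measure Ω}

lemma Run.prof_elimLength_rationalizable {R : Run G ε Δ δ T μ} {ω : Ω} (h : ω ∉ R.initFailure)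
    (i : Fin N) : Rationalizable G Δ i (R.prof (elimLength G Δ) ω i) := by
  refine bestResponse_notMem_elim (prof := fun l => R.prof l ω) (fun l p => not_le.1 fun hle => ?_)
    (fun l i a => R.prof_best l ω i a) le_rfl i
  exact h ⟨(l, p), hle⟩

variable [∀ i, Nonempty (A i)]

lemma Run.isCCE_and_playsRationalizable (H : Admissible N (maxActions A) ε Δ δ)
    (hT : numRounds N (maxActions A) ε Δ δ ≤ T) {R : Run G ε Δ δ T μ} {ω : Ω}
    (hinit : ω ∉ R.initFailure) (hest : ω ∉ R.estimateFailure) (hreg : ω ∉ R.regretFailure) :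
    IsCCE G ε (R.result ω) ∧ PlaysRationalizable G Δ (R.result ω) := by
  have hregret (p : Σ i, A i) := not_or.1 fun h => hreg ⟨p, h⟩
  refine ⟨output_isCCE H hT (fun s => R.fb_mem s ω _) (fun p => (not_le.1 (hregret p).1).le)
    fun i => (not_le.1 (hregret ⟨i, Classical.arbitrary _⟩).2).le,
    output_playsRationalizable fun t ht p hp => ?_⟩
  refine hedge_lt_clipThreshold H.one_le_players H.eps_pos H.eps_le_one H.gap_pos H.gap_le_one
    (prof_elimLength_rationalizable hinit) (fun n hn hnT p => ?_) ht.le hp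
  obtain ⟨k, rfl⟩ := Nat.exists_eq_add_of_le' hn
  exact not_le.1 fun h => hest ⟨(⟨k, hnT⟩, p), h⟩

theorem Run.le_measure_success [IsProbabilityMeasure μ] (R : Run G ε Δ δ T μ)
    (H : Admissible N (maxActions A) ε Δ δ) (hT : numRounds N (maxActions A) ε Δ δ ≤ T) :
    ENNReal.ofReal (1 - 3 * δ) ≤
      μ {ω | IsCCE G ε (R.result ω) ∧ PlaysRationalizable G Δ (R.result ω)} := by
  obtain hδ3 | hδ3 := le_total (1 / 3) δ
  · rw [ENNReal.ofReal_of_nonpos (by linarith)]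
    exact zero_le
  have hT1 : 1 ≤ T := H.one_le_numRounds.trans hT
  set success := {ω | IsCCE G ε (R.result ω) ∧ PlaysRationalizable G Δ (R.result ω)}
  have hcover : Set.univ ⊆ success ∪ (R.initFailure ∪ R.estimateFailure ∪ R.regretFailure) := by
    intro ω _
    by_contra hω
    simp only [Set.mem_union, not_or] at hω
    obtain ⟨hfail, ⟨hinit, hest⟩, hreg⟩ := hω
    exact hfail (Run.isCCE_and_playsRationalizable H hT hinit hest hreg)
  rw [← ofReal_measureReal]
  refine ENNReal.ofReal_le_ofReal ?_
  have hunion := (probReal_univ (μ := μ)).symm.trans_le (measureReal_mono (μ := μ) hcover)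
  grw [measureReal_union_le, measureReal_union_le, measureReal_union_le,
    R.measureReal_initFailure_le H (by linarith),
    R.measureReal_estimateFailure_le H hT1 (by linarith), R.measureReal_regretFailure_le H hT1]
    at hunion
  linarith

end Main

end RationalizableCCE

end

theorem mainTheorem1 :
    ∃ (C : ℝ) (k : ℕ) (T₀ : ℕ → ℕ → ℝ → ℝ → ℝ → ℕ), 0 < C ∧
      (∀ (n m : ℕ) (ε Δ δ : ℝ), 1 ≤ n → 1 ≤ m → 0 < ε → ε ≤ 1 → 0 < Δ → Δ ≤ 1 → 0 < δ → δ < 1 →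
        (T₀ n m ε Δ δ : ℝ)
          ≤ C * Real.log (2 * n * m / (ε * Δ * δ)) ^ k * (1 / ε ^ 2 + 1 / (ε * Δ))) ∧
      ∀ (N : ℕ) (A : Fin N → Type*) [∀ i, Fintype (A i)] [∀ i, Nonempty (A i)]
        (G : RationalizableCCE.Game A) (ε Δ δ : ℝ),
        1 ≤ N → 0 < ε → ε ≤ 1 → 0 < Δ → Δ ≤ 1 → 0 < δ → δ < 1 →
        (∀ (T : ℕ), T₀ N (RationalizableCCE.maxActions A) ε Δ δ ≤ T →
          ∀ (Ω : Type*) [MeasurableSpace Ω] (μ : MeasureTheory.Measure Ω)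
            [MeasureTheory.IsProbabilityMeasure μ] (R : RationalizableCCE.Run G ε Δ δ T μ),
            ENNReal.ofReal (1 - 3 * δ) ≤
              μ {ω | RationalizableCCE.IsCCE G ε (R.result ω) ∧
                RationalizableCCE.PlaysRationalizable G Δ (R.result ω)}) ∧
        (RationalizableCCE.sampleCount G Δ δ
            (T₀ N (RationalizableCCE.maxActions A) ε Δ δ) : ℝ)
          ≤ C * Real.log (2 * N * RationalizableCCE.maxActions A * RationalizableCCE.elimLength G Δ
                / (ε * Δ * δ)) ^ k *
            (RationalizableCCE.elimLength G Δ * N * RationalizableCCE.maxActions A / Δ ^ 2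
              + N * RationalizableCCE.maxActions A / ε ^ 2) := by
  refine ⟨30000, 2, RationalizableCCE.numRounds, by norm_num, ?_, ?_⟩
  · intro n m ε Δ δ hn hm hε hε1 hΔ hΔ1 hδ hδ1
    have H : RationalizableCCE.Admissible n m ε Δ δ := ⟨hn, hm, hε, hε1, hΔ, hΔ1, hδ, hδ1⟩
    refine H.numRounds_le.trans ?_
    unfold RationalizableCCE.logFactor
    gcongr
    norm_num
  · intro N A _ _ G ε Δ δ hN hε hε1 hΔ hΔ1 hδ hδ1
    have H : RationalizableCCE.Admissible N (RationalizableCCE.maxActions A) ε Δ δ :=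
      ⟨hN, RationalizableCCE.one_le_maxActions hN, hε, hε1, hΔ, hΔ1, hδ, hδ1⟩
    exact ⟨fun T hT Ω _ μ _ R => R.le_measure_success H hT,
      RationalizableCCE.sampleCount_numRounds_le G H⟩
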